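/- Let $n\ge 1$. A convex body in $\mathbb R^n$ is a compact convex set with non-empty interior. For a convex body $K\subset\mathbb R^n$ let $S(K)$ be its surface area, i.e. the $(n-1)$-dimensional Hausdorff measure of the boundary $\partial K$ (normalized to agree with Lebesgue measure on hyperplanes; it is the number of boundary points if $n=1$). Let $\Pi K$ be the projection body of $K$, the convex body whose support function is $h_{\Pi K}(u)=\mathrm{vol}_{n-1}(P_{u^\perp}K)$ for every unit vector $u$, where $P_{u^\perp}K$ is the orthogonal projection of $K$ onto the hyperplane $u^\perp$, and let $\Pi^\circ K=\{x\in\mathbb R^n:\langle x,y\rangle\le 1\text{ for all }y\in\Pi K\}$ be its polar body. Let $B_2^n$ be the Euclidean unit ball of $\mathbb R^n$ and $\omega_n=\mathrm{vol}(B_2^n)$ (with $\omega_0=1$). Then for every convex body $K\subset\mathbb R^n$, $$S(K)^n\,\mathrm{vol}(\Pi^\circ K)\ \ge\ \omega_n\left(\frac{n\,\omega_n}{\omega_{n-1}}\right)^n .$$ Moreover, equality holds if $K=B_2^n$. -/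

import Mathlib

open MeasureTheory Metric
open scoped RealInnerProductSpace

noncomputable section

/-- The volume of the Euclidean unit ball of `ℝⁿ`. -/
def unitBallVolume (n : ℕ) : ℝ :=
  volume.real (closedBall (0 : EuclideanSpace ℝ (Fin n)) 1)

/-- The support function of `K`. -/
def supportFunction {n : ℕ} (K : Set (EuclideanSpace ℝ (Fin n)))
    (x : EuclideanSpace ℝ (Fin n)) : ℝ :=
  sSup ((fun y => ⟪x, y⟫) '' K)

/-- The polar of `K`. -/
def polarBody {n : ℕ} (K : Set (EuclideanSpace ℝ (Fin n))) :
    Set (EuclideanSpace ℝ (Fin n)) :=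
  {x | ∀ y ∈ K, ⟪x, y⟫ ≤ 1}

/-- The surface area of `K`: the `(n - 1)`-dimensional Hausdorff measure of its boundary,
normalized so that it agrees with Lebesgue measure on hyperplanes (counting measure if `n = 1`). -/
def surfaceArea {n : ℕ} (K : Set (EuclideanSpace ℝ (Fin n))) : ℝ :=
  (Measure.euclideanHausdorffMeasure (n - 1)).real (frontier K)

/-- The `(n - 1)`-dimensional volume of the orthogonal projection of `K` onto `u^⊥`. -/
def projectionVolume {n : ℕ} (K : Set (EuclideanSpace ℝ (Fin n)))
    (u : EuclideanSpace ℝ (Fin n)) : ℝ :=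
  (Measure.euclideanHausdorffMeasure (n - 1)).real ((ℝ ∙ u)ᗮ.starProjection '' K)

/-- The projection body `Π K`: the convex body whose support function at each unit vector `u` is
the volume of the projection of `K` onto `u^⊥`. A closed convex set is the intersection of its
supporting half-spaces, so this is the set below
(see `eq_projectionBody_of_supportFunction_eq`). -/
def projectionBody {n : ℕ} (K : Set (EuclideanSpace ℝ (Fin n))) :
    Set (EuclideanSpace ℝ (Fin n)) :=
  {x | ∀ u : EuclideanSpace ℝ (Fin n), ‖u‖ = 1 → ⟪u, x⟫ ≤ projectionVolume K u}

/-- The polar projection body `Π° K`. -/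
def polarProjectionBody {n : ℕ} (K : Set (EuclideanSpace ℝ (Fin n))) :
    Set (EuclideanSpace ℝ (Fin n)) :=
  polarBody (projectionBody K)

/-- A compact convex set whose support function on the unit sphere is the projection volume of `K`
is the projection body of `K`. -/
theorem eq_projectionBody_of_supportFunction_eq {n : ℕ} (K : Set (EuclideanSpace ℝ (Fin n)))
    (P : ConvexBody (EuclideanSpace ℝ (Fin n)))
    (hP : ∀ u : EuclideanSpace ℝ (Fin n), ‖u‖ = 1 →
      supportFunction (P : Set (EuclideanSpace ℝ (Fin n))) u = projectionVolume K u) :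
    (P : Set (EuclideanSpace ℝ (Fin n))) = projectionBody K := by
  have hbdd : ∀ u : EuclideanSpace ℝ (Fin n),
      BddAbove ((fun y => ⟪u, y⟫) '' (P : Set (EuclideanSpace ℝ (Fin n)))) := fun u =>
    (P.isCompact.image (by fun_prop)).bddAbove
  ext x
  constructor
  · intro hx u hu
    rw [← hP u hu]
    exact le_csSup (hbdd u) ⟨x, hx, rfl⟩
  · intro hx
    by_contra hxP
    obtain ⟨f, s, hfs, hsx⟩ := geometric_hahn_banach_closed_point P.convex P.isCompact.isClosed hxP
    obtain ⟨v, rfl⟩ := (InnerProductSpace.toDual ℝ (EuclideanSpace ℝ (Fin n))).surjective f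
    simp only [InnerProductSpace.toDual_apply_apply] at hfs hsx
    have hv : v ≠ 0 := by
      rintro rfl
      obtain ⟨y, hy⟩ := P.nonempty
      have := hfs y hy
      simp only [inner_zero_left] at this hsx
      linarith
    have hv' : 0 < ‖v‖ := norm_pos_iff.mpr hv
    have hu : ‖(‖v‖⁻¹ • v)‖ = 1 := by
      rw [norm_smul, norm_inv, norm_norm, inv_mul_cancel₀ hv'.ne']
    have h1 := hx _ hu
    rw [← hP _ hu] at h1
    have h2 : supportFunction (P : Set (EuclideanSpace ℝ (Fin n))) (‖v‖⁻¹ • v) ≤ ‖v‖⁻¹ * s := by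
      refine csSup_le (P.nonempty.image _) ?_
      rintro _ ⟨y, hy, rfl⟩
      simp only [real_inner_smul_left]
      exact mul_le_mul_of_nonneg_left (hfs y hy).le (by positivity)
    rw [real_inner_smul_left] at h1
    have h3 := mul_lt_mul_of_pos_left hsx (inv_pos.mpr hv')
    linarith

end

/-! By Cauchy's formula, the mean over the unit sphere of the support function of `Π K` is `m =
ω_{n-1} S(K) / (n ω_n)`. In polar coordinates `vol(Π° K)` is `1/n` times the integral of the `-n`-th
power of that support function. As `t ↦ t⁻ⁿ` is convex, Jensen's inequality gives `vol(Π° K) ≥ ω_n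
m⁻ⁿ`, which is the claim.

Cauchy's formula is needed only for polyhedra, where projected area is a finite sum over facets: a
facet of area `a` and unit normal `ν` contributes `a ⟪ν, u⟫₊`. The sum, `facetGauge`, is positively
homogeneous, and its sphere integral is computed facet by facet (`integral_facetGauge`).

A general `K` is reached by placing a polyhedron `P` between a homothetic copy of `K` with ratio `c
< 1` and `K` itself (`exists_polyhedron_between`). The projections of `P` are at least `c ^ (n - 1)`
times those of `K`, while `S(P) ≤ S(K)`, because expanding the boundary of a convex body outwards
along normals does not decrease distances (`Convex.euclideanHausdorffMeasure_frontier_le`). Applying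
`unitBallVolume_le_of_homogeneous` to the rescaled gauge of `P` gives the bound up to a power of
`c`; then `c → 1`.

For the ball, `Π°` is an explicit ball and `S ≤ n ω_n` follows from circumscribed polyhedra. The
opposite inequality is the general bound. -/

/-- A preconnected set meeting both a set and its complement meets the frontier of that set. -/
theorem IsPreconnected.inter_frontier_nonempty {X : Type*} [TopologicalSpace X] {S s : Set X}
    (hS : IsPreconnected S) (h1 : (S ∩ s).Nonempty) (h2 : (S ∩ sᶜ).Nonempty) :
    (S ∩ frontier s).Nonempty := by
  by_contra hcon
  have hno : ∀ x ∈ S, x ∉ frontier s := fun x hx hf => hcon ⟨x, hx, hf⟩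
  have hcov : S ⊆ interior s ∪ interior sᶜ := by
    intro x hx
    by_contra hx'
    rw [Set.mem_union, not_or] at hx'
    refine hno x hx ?_
    rw [frontier_eq_inter_compl_interior]
    exact ⟨hx'.1, hx'.2⟩
  obtain ⟨x, hx, hxs⟩ := h1
  obtain ⟨y, hy, hys⟩ := h2
  obtain ⟨z, -, hz, hz'⟩ := hS _ _ isOpen_interior isOpen_interior hcov
    ⟨x, hx, (hcov hx).resolve_right fun h => interior_subset h hxs⟩
    ⟨y, hy, (hcov hy).resolve_left fun h => hys (interior_subset h)⟩
  exact interior_subset hz' (interior_subset hz)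

/-! ### Supporting normals and monotonicity of boundary measure -/

section Convexity

variable {E : Type*} [NormedAddCommGroup E] [InnerProductSpace ℝ E]

/-- A ray issuing from a point of a bounded set meets the frontier of that set. -/
theorem exists_nonneg_add_smul_mem_frontier {s : Set E} (hs : Bornology.IsBounded s) {x v : E}
    (hx : x ∈ s) (hv : v ≠ 0) : ∃ t : ℝ, 0 ≤ t ∧ x + t • v ∈ frontier s := by
  have hpre : IsPreconnected ((fun t : ℝ => x + t • v) '' Set.Ici 0) :=
    (isPreconnected_Ici).image _ (by fun_prop)
  have h1 : ((fun t : ℝ => x + t • v) '' Set.Ici 0 ∩ s).Nonempty :=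
    ⟨x, ⟨0, by simp, by simp⟩, hx⟩
  have h2 : ((fun t : ℝ => x + t • v) '' Set.Ici 0 ∩ sᶜ).Nonempty := by
    by_contra hcon
    rw [Set.not_nonempty_iff_eq_empty] at hcon
    obtain ⟨R, hR⟩ := hs.subset_closedBall x
    have hv' : 0 < ‖v‖ := norm_pos_iff.mpr hv
    have hmem : x + ((|R| + 1) / ‖v‖) • v ∈ s := by
      by_contra hns
      have : x + ((|R| + 1) / ‖v‖) • v ∈
          (fun t : ℝ => x + t • v) '' Set.Ici 0 ∩ sᶜ :=
        ⟨⟨(|R| + 1) / ‖v‖, by simp only [Set.mem_Ici]; positivity, rfl⟩, hns⟩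
      rw [hcon] at this
      exact this
    have h3 := hR hmem
    rw [mem_closedBall, dist_eq_norm, add_sub_cancel_left, norm_smul, Real.norm_eq_abs,
      abs_of_nonneg (by positivity), div_mul_cancel₀ _ hv'.ne'] at h3
    linarith [le_abs_self R]
  obtain ⟨_, ⟨t, ht, rfl⟩, hf⟩ := hpre.inter_frontier_nonempty h1 h2
  exact ⟨t, ht, hf⟩

/-- A supporting functional at a boundary point of a convex set with non-empty interior. -/
theorem Convex.exists_inner_le_of_mem_frontier [CompleteSpace E] {C : Set E} (hC : Convex ℝ C)
    (hint : (interior C).Nonempty) {y : E} (hy : y ∈ frontier C) :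
    ∃ v : E, v ≠ 0 ∧ ∀ z ∈ C, ⟪v, z⟫ ≤ ⟪v, y⟫ := by
  obtain ⟨f, hf⟩ := geometric_hahn_banach_open_point hC.interior isOpen_interior hy.2
  obtain ⟨v, rfl⟩ := (InnerProductSpace.toDual ℝ E).surjective f
  simp only [InnerProductSpace.toDual_apply_apply] at hf
  refine ⟨v, ?_, ?_⟩
  · rintro rfl
    obtain ⟨z, hz⟩ := hint
    simpa using hf z hz
  · intro z hz
    have hz' : z ∈ closure (interior C) := by
      rw [hC.closure_interior_eq_closure_of_nonempty_interior hint]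
      exact subset_closure hz
    have hcl : IsClosed {w : E | ⟪v, w⟫ ≤ ⟪v, y⟫} := isClosed_le (by fun_prop) (by fun_prop)
    exact closure_minimal (fun w hw => (hf w hw).le) hcl hz'

/-- The boundary of a convex body has at most the measure of the boundary of any bounded set
containing the body. -/
theorem Convex.euclideanHausdorffMeasure_frontier_le [CompleteSpace E] [MeasurableSpace E]
    [BorelSpace E] (d : ℕ) {C L : Set E} (hC : Convex ℝ C) (hcl : IsClosed C)
    (hint : (interior C).Nonempty) (hL : Bornology.IsBounded L) (hCL : C ⊆ L) :
    μHE[d] (frontier C) ≤ μHE[d] (frontier L) := by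
  -- Follow an outer normal of `C` at `y` until it meets the frontier of `L`. Then `y` is the point
  -- of `C` nearest to `x`, so this selects a right inverse of the nearest-point projection.
  have hex : ∀ y : E, ∃ x : E, y ∈ frontier C →
      x ∈ frontier L ∧ ∀ z ∈ C, ⟪x - y, z - y⟫ ≤ 0 := by
    intro y
    by_cases hy : y ∈ frontier C
    · obtain ⟨v, hv, hvC⟩ := hC.exists_inner_le_of_mem_frontier hint hy
      obtain ⟨t, ht, hf⟩ :=
        exists_nonneg_add_smul_mem_frontier hL (hCL (hcl.frontier_subset hy)) hv
      refine ⟨_, fun _ => ⟨hf, fun z hz => ?_⟩⟩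
      rw [add_sub_cancel_left, real_inner_smul_left, inner_sub_right]
      exact mul_nonpos_of_nonneg_of_nonpos ht (by linarith [hvC z hz])
    · exact ⟨y, fun h => absurd h hy⟩
  choose f hf using hex
  have hanti : ∀ y ∈ frontier C, ∀ y' ∈ frontier C, dist y y' ≤ dist (f y) (f y') := by
    intro y hy y' hy'
    have h1 := (hf y hy).2 y' (hcl.frontier_subset hy')
    have h2 := (hf y' hy').2 y (hcl.frontier_subset hy)
    -- The sum of the two normal-cone inequalities `h1` and `h2`; Cauchy–Schwarz then yields the
    -- distance estimate.
    have h3 : ‖y - y'‖ ^ 2 ≤ ⟪f y - f y', y - y'⟫ := by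
      rw [← real_inner_self_eq_norm_sq]
      have e1 : ⟪f y - y, y' - y⟫ = -⟪f y - y, y - y'⟫ := by
        rw [← inner_neg_right, neg_sub]
      have e2 : ⟪f y - f y', y - y'⟫ - ⟪y - y', y - y'⟫
          = ⟪f y - y, y - y'⟫ - ⟪f y' - y', y - y'⟫ := by
        rw [← inner_sub_left, ← inner_sub_left]; congr 1; abel
      linarith
    have h4 := h3.trans (real_inner_le_norm _ _)
    rw [dist_eq_norm, dist_eq_norm]
    rcases (norm_nonneg (y - y')).eq_or_lt with h | h
    · rw [← h]; positivity
    · nlinarith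
  have hinj : Set.InjOn f (frontier C) := by
    intro y hy y' hy' h
    have := hanti y hy y' hy'
    rw [h, dist_self] at this
    exact dist_le_zero.mp this
  rcases Set.eq_empty_or_nonempty (frontier C) with h0 | ⟨y0, hy0⟩
  · simp [h0]
  have : Nonempty E := ⟨y0⟩
  have hleft : ∀ y ∈ frontier C, Function.invFunOn f (frontier C) (f y) = y :=
    fun y hy => hinj.leftInvOn_invFunOn hy
  have hlip : LipschitzOnWith 1 (Function.invFunOn f (frontier C)) (f '' frontier C) := by
    refine LipschitzOnWith.of_dist_le_mul ?_
    rintro _ ⟨y, hy, rfl⟩ _ ⟨y', hy', rfl⟩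
    rw [hleft y hy, hleft y' hy', NNReal.coe_one, one_mul]
    exact hanti y hy y' hy'
  have himg : Function.invFunOn f (frontier C) '' (f '' frontier C) = frontier C := by
    rw [Set.image_image]
    exact (Set.image_congr hleft).trans (Set.image_id' _)
  have hmain : μH[d] (frontier C) ≤ μH[d] (frontier L) := by
    calc μH[d] (frontier C) = μH[d] (Function.invFunOn f (frontier C) '' (f '' frontier C)) := by
          rw [himg]
      _ ≤ _ := hlip.hausdorffMeasure_image_le (Nat.cast_nonneg d)
      _ = μH[d] (f '' frontier C) := by simp
      _ ≤ _ := measure_mono (Set.image_subset_iff.mpr fun y hy => (hf y hy).1)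
  simp only [Measure.euclideanHausdorffMeasure_def, Measure.smul_apply]
  gcongr

end Convexity

/-! ### Polyhedra, their facets and polyhedral approximation -/

section Polyhedron

variable {E : Type*} [NormedAddCommGroup E] [InnerProductSpace ℝ E] {k : ℕ}

/-- The intersection of the half-spaces `⟪ν i, x⟫ ≤ d i`. -/
def polyhedron (ν : Fin k → E) (d : Fin k → ℝ) : Set E :=
  {x | ∀ i, ⟪ν i, x⟫ ≤ d i}

/-- The part of the `i`-th face of a polyhedron not contained in the preceding faces. -/
def facetPiece (ν : Fin k → E) (d : Fin k → ℝ) (i : Fin k) : Set E :=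
  {x | x ∈ polyhedron ν d ∧ ⟪ν i, x⟫ = d i ∧ ∀ j < i, ⟪ν j, x⟫ ≠ d j}

theorem isClosed_polyhedron (ν : Fin k → E) (d : Fin k → ℝ) : IsClosed (polyhedron ν d) := by
  rw [polyhedron, Set.ofPred_forall]
  exact isClosed_iInter fun i => isClosed_le (by fun_prop) (by fun_prop)

theorem convex_polyhedron (ν : Fin k → E) (d : Fin k → ℝ) : Convex ℝ (polyhedron ν d) := by
  rw [polyhedron, Set.ofPred_forall]
  exact convex_iInter fun i => convex_halfSpace_le
    (f := fun x => ⟪ν i, x⟫) ⟨fun x y => inner_add_right _ _ _, fun c x => by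
      simp [real_inner_smul_right]⟩ _

theorem mem_interior_polyhedron {ν : Fin k → E} {d : Fin k → ℝ} (hν : ∀ i, ν i ≠ 0) {x : E} :
    x ∈ interior (polyhedron ν d) ↔ ∀ i, ⟪ν i, x⟫ < d i := by
  constructor
  · intro hx i
    have hcont : Filter.Tendsto (fun t : ℝ => x + t • ν i) (nhds 0) (nhds x) := by
      have : Continuous (fun t : ℝ => x + t • ν i) := by fun_prop
      simpa using this.tendsto 0
    have hev := hcont.eventually (mem_interior_iff_mem_nhds.mp hx)
    obtain ⟨ε, hε, hball⟩ := Metric.eventually_nhds_iff.mp hev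
    have hmem := hball (y := ε / 2) (by rw [Real.dist_eq, sub_zero, abs_of_pos] <;> linarith) i
    rw [inner_add_right, real_inner_smul_right, real_inner_self_eq_norm_sq] at hmem
    have : 0 < ε / 2 * ‖ν i‖ ^ 2 := by
      have := norm_pos_iff.mpr (hν i); positivity
    linarith
  · intro hx
    have hopen : IsOpen {x : E | ∀ i, ⟪ν i, x⟫ < d i} := by
      rw [Set.ofPred_forall]
      exact isOpen_iInter_of_finite fun i => isOpen_lt (by fun_prop) (by fun_prop)
    exact interior_maximal (fun y hy i => (hy i).le) hopen hx

theorem measurableSet_facetPiece [MeasurableSpace E] [BorelSpace E] (ν : Fin k → E)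
    (d : Fin k → ℝ) (i : Fin k) : MeasurableSet (facetPiece ν d i) := by
  have h : facetPiece ν d i = polyhedron ν d ∩ ({x | ⟪ν i, x⟫ = d i} ∩
      ⋂ j : Fin k, ⋂ _ : j < i, {x | ⟪ν j, x⟫ = d j}ᶜ) := by
    ext x; simp only [facetPiece, Set.mem_ofPred_eq, Set.mem_inter_iff, Set.mem_iInter,
      Set.mem_compl_iff, ne_eq]
  have hc : ∀ j, IsClosed {x : E | ⟪ν j, x⟫ = d j} := fun j =>
    isClosed_eq (by fun_prop) (by fun_prop)
  rw [h]
  exact (isClosed_polyhedron ν d).measurableSet.inter ((hc i).measurableSet.inter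
    (MeasurableSet.iInter fun j => MeasurableSet.iInter fun _ => (hc j).measurableSet.compl))

theorem facetPiece_eq_of_mem {ν : Fin k → E} {d : Fin k → ℝ} {i j : Fin k} {x : E}
    (hi : x ∈ facetPiece ν d i) (hj : x ∈ facetPiece ν d j) : i = j := by
  rcases lt_trichotomy i j with h | h | h
  · exact absurd hi.2.1 (hj.2.2 i h)
  · exact h
  · exact absurd hj.2.1 (hi.2.2 j h)

theorem frontier_polyhedron {ν : Fin k → E} {d : Fin k → ℝ} (hν : ∀ i, ν i ≠ 0) :
    frontier (polyhedron ν d) = ⋃ i, facetPiece ν d i := by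
  classical
  ext x
  rw [(isClosed_polyhedron ν d).frontier_eq, Set.mem_sdiff, mem_interior_polyhedron hν,
    Set.mem_iUnion]
  constructor
  · rintro ⟨hx, hx'⟩
    push Not at hx'
    have hex : ∃ i, ⟪ν i, x⟫ = d i := hx'.imp fun i hi => le_antisymm (hx i) hi
    let s : Finset (Fin k) := Finset.univ.filter fun i => ⟪ν i, x⟫ = d i
    have hs : s.Nonempty := by
      obtain ⟨i, hi⟩ := hex
      exact ⟨i, by simp [s, hi]⟩
    refine ⟨s.min' hs, hx, (Finset.mem_filter.mp (s.min'_mem hs)).2, fun j hj hjd => ?_⟩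
    exact absurd (s.min'_le j (by simp [s, hjd])) (not_le.mpr hj)
  · rintro ⟨i, hx, hi, -⟩
    exact ⟨hx, fun h => (h i).ne hi⟩

theorem euclideanHausdorffMeasure_frontier_polyhedron [MeasurableSpace E] [BorelSpace E] (m : ℕ)
    {ν : Fin k → E} {d : Fin k → ℝ} (hν : ∀ i, ν i ≠ 0) :
    μHE[m] (frontier (polyhedron ν d)) = ∑ i, μHE[m] (facetPiece ν d i) := by
  rw [frontier_polyhedron hν, measure_iUnion _ (measurableSet_facetPiece ν d), tsum_fintype]
  intro i j hij
  exact Set.disjoint_left.mpr fun x hi hj => hij (facetPiece_eq_of_mem hi hj)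

/-- A compact convex set in the interior of a compact set can be separated from the complement by
a polyhedron. -/
theorem exists_polyhedron_between [CompleteSpace E] {C L : Set E} (hC : Convex ℝ C)
    (hCc : IsCompact C) (hCn : C.Nonempty) (hL : IsCompact L) (hCL : C ⊆ interior L) :
    ∃ (k : ℕ) (ν : Fin k → E) (d : Fin k → ℝ), (∀ i, ‖ν i‖ = 1) ∧
      C ⊆ interior (polyhedron ν d) ∧ polyhedron ν d ⊆ L := by
  have hsep : ∀ x : E, ∃ (v : E) (c : ℝ), x ∈ frontier L →
      ‖v‖ = 1 ∧ (∀ z ∈ C, ⟪v, z⟫ < c) ∧ c < ⟪v, x⟫ := by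
    intro x
    by_cases hx : x ∈ frontier L
    swap
    · exact ⟨0, 0, fun h => absurd h hx⟩
    have hxC : x ∉ C := fun h => hx.2 (hCL h)
    obtain ⟨f, s, hfs, hsx⟩ := geometric_hahn_banach_closed_point hC hCc.isClosed hxC
    obtain ⟨v, rfl⟩ := (InnerProductSpace.toDual ℝ E).surjective f
    simp only [InnerProductSpace.toDual_apply_apply] at hfs hsx
    have hv : v ≠ 0 := by
      rintro rfl
      obtain ⟨y, hy⟩ := hCn
      have := hfs y hy
      simp only [inner_zero_left] at this hsx
      linarith
    have hv' : 0 < ‖v‖ := norm_pos_iff.mpr hv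
    refine ⟨‖v‖⁻¹ • v, ‖v‖⁻¹ * s, fun _ => ⟨?_, fun z hz => ?_, ?_⟩⟩
    · rw [norm_smul, norm_inv, norm_norm, inv_mul_cancel₀ hv'.ne']
    · rw [real_inner_smul_left]
      exact mul_lt_mul_of_pos_left (hfs z hz) (inv_pos.mpr hv')
    · rw [real_inner_smul_left]
      exact mul_lt_mul_of_pos_left hsx (inv_pos.mpr hv')
  choose v c hvc using hsep
  have hfc : IsCompact (frontier L) := hL.of_isClosed_subset isClosed_frontier
    hL.isClosed.frontier_subset
  -- By compactness, finitely many of the half-spaces separating `C` from points of the frontier of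
  -- `L` already exclude the whole frontier.
  obtain ⟨t, ht, hcov⟩ := hfc.elim_nhds_subcover (fun x => {y : E | c x < ⟪v x, y⟫})
    fun x hx => (isOpen_lt (by fun_prop) (by fun_prop)).mem_nhds (hvc x hx).2.2
  let e := t.equivFin
  have hmem : ∀ i, ((e.symm i : t) : E) ∈ frontier L := fun i => ht _ (e.symm i).2
  have hunit : ∀ i, ‖v (e.symm i : t)‖ = 1 := fun i => (hvc _ (hmem i)).1
  refine ⟨t.card, fun i => v (e.symm i : t), fun i => c (e.symm i : t), hunit, ?_, ?_⟩
  · intro x hx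
    rw [mem_interior_polyhedron fun i h => by simpa [h] using hunit i]
    exact fun i => (hvc _ (hmem i)).2.1 x hx
  -- The polyhedron is connected and meets `L`, so leaving `L` would force it across the frontier,
  -- every point of which violates one of the inequalities.
  · by_contra hnot
    obtain ⟨x, hxP, hxL⟩ := Set.not_subset.mp hnot
    obtain ⟨y, hy⟩ := hCn
    have hyP : y ∈ polyhedron (fun i => v (e.symm i : t)) (fun i => c (e.symm i : t)) :=
      fun i => ((hvc _ (hmem i)).2.1 y hy).le
    obtain ⟨z, hzP, hzL⟩ := (convex_polyhedron (fun i => v (e.symm i : t))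
      (fun i => c (e.symm i : t))).isPreconnected.inter_frontier_nonempty
        ⟨y, hyP, interior_subset (hCL hy)⟩ ⟨x, hxP, hxL⟩
    have hz := hcov hzL
    simp only [Set.mem_iUnion, Set.mem_ofPred_eq] at hz
    obtain ⟨w, hw, hlt⟩ := hz
    have := hzP (e ⟨w, hw⟩)
    simp only [Equiv.symm_apply_apply] at this
    linarith

end Polyhedron

/-! ### Area of the projection of a hyperplane piece -/

section Projection

variable {E : Type*} [NormedAddCommGroup E] [InnerProductSpace ℝ E]

theorem starProjection_orthogonal_unit {u : E} (hu : ‖u‖ = 1) (x : E) :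
    (ℝ ∙ u)ᗮ.starProjection x = x - ⟪u, x⟫ • u := by
  rw [Submodule.starProjection_orthogonal_val, Submodule.starProjection_unit_singleton ℝ hu]

variable [MeasurableSpace E] [BorelSpace E]

/-- The set swept out when a subset of the hyperplane `⟪v, x⟫ = d` is translated along the unit
segment in direction `u`. -/
def sweptSet (A : Set E) (v u : E) (d : ℝ) : Set E :=
  {y | (⟪v, y⟫ - d) / ⟪v, u⟫ ∈ Set.Icc (0 : ℝ) 1 ∧ y - ((⟪v, y⟫ - d) / ⟪v, u⟫) • u ∈ A}

theorem measurableSet_sweptSet {A : Set E} (hA : MeasurableSet A) (v u : E) (d : ℝ) :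
    MeasurableSet (sweptSet A v u d) := by
  have h1 : Continuous fun y : E => (⟪v, y⟫ - d) / ⟪v, u⟫ := by fun_prop
  have h2 : Continuous fun y : E => y - ((⟪v, y⟫ - d) / ⟪v, u⟫) • u := by fun_prop
  exact (h1.measurable measurableSet_Icc).inter (h2.measurable hA)

variable [FiniteDimensional ℝ E]

/-- Cavalieri in direction `v`: the slices are translates of `A` for heights between `d` and `d +
⟪v, u⟫`, and empty otherwise. -/
theorem sweptSet_measure {A : Set E} (hA : MeasurableSet A) {v u : E} {d : ℝ}
    (hv : ‖v‖ = 1) (hvu : ⟪v, u⟫ ≠ 0) (hAd : ∀ a ∈ A, ⟪v, a⟫ = d) :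
    μHE[Module.finrank ℝ E] (sweptSet A v u d) =
      ENNReal.ofReal |⟪v, u⟫| * μHE[Module.finrank ℝ E - 1] A := by
  have hv0 : v ≠ 0 := by rintro rfl; simp at hv
  have hvv : ⟪v, v⟫ = 1 := by rw [real_inner_self_eq_norm_sq, hv, one_pow]
  rw [EuclideanGeometry.euclideanHausdorffMeasure_eq_lintegral (0 : E) hv0
    (measurableSet_sweptSet hA v u d)]
  have hmem : ∀ (x : ℝ) (y : E), y ∈ AffineSubspace.mk' (x • v +ᵥ (0 : E)) (ℝ ∙ v)ᗮ ↔
      ⟪v, y⟫ = x := by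
    intro x y
    rw [AffineSubspace.mem_mk', Submodule.mem_orthogonal_singleton_iff_inner_right]
    simp only [vadd_eq_add, add_zero, vsub_eq_sub, inner_sub_right, real_inner_smul_right, hvv,
      mul_one, sub_eq_zero]
  have hslice : ∀ x : ℝ, μHE[Module.finrank ℝ E - 1]
      (sweptSet A v u d ∩ AffineSubspace.mk' (x • v +ᵥ (0 : E)) (ℝ ∙ v)ᗮ) =
      ((fun x : ℝ => (x - d) / ⟪v, u⟫) ⁻¹' Set.Icc 0 1).indicator
        (fun _ => μHE[Module.finrank ℝ E - 1] A) x := by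
    intro x
    by_cases hx : (x - d) / ⟪v, u⟫ ∈ Set.Icc (0 : ℝ) 1
    · rw [Set.indicator_of_mem (by exact hx),
        ← measure_vadd (μHE[Module.finrank ℝ E - 1]) (((x - d) / ⟪v, u⟫) • u) A]
      congr 1
      ext y
      rw [Set.mem_inter_iff, SetLike.mem_coe, hmem, Set.mem_vadd_set_iff_neg_vadd_mem, vadd_eq_add,
        neg_add_eq_sub, sweptSet, Set.mem_ofPred_eq]
      constructor
      · rintro ⟨⟨-, h⟩, rfl⟩
        exact h
      · intro h
        have h1 := hAd _ h
        rw [inner_sub_right, real_inner_smul_right, div_mul_cancel₀ _ hvu] at h1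
        have h2 : ⟪v, y⟫ = x := by linarith
        rw [h2]
        exact ⟨⟨hx, h⟩, rfl⟩
    · rw [Set.indicator_of_notMem (by exact hx)]
      convert measure_empty
      · rw [Set.eq_empty_iff_forall_notMem]
        rintro y ⟨⟨h, -⟩, hy⟩
        rw [SetLike.mem_coe, hmem] at hy
        rw [hy] at h
        exact hx h
      · infer_instance
  simp_rw [hslice]
  have hmeas : MeasurableSet ((fun x : ℝ => (x - d) / ⟪v, u⟫) ⁻¹' Set.Icc 0 1) := by
    have : Continuous fun x : ℝ => (x - d) / ⟪v, u⟫ := by fun_prop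
    exact this.measurable measurableSet_Icc
  have hset : (fun x : ℝ => (x - d) / ⟪v, u⟫) ⁻¹' Set.Icc 0 1 = Set.uIcc d (d + ⟪v, u⟫) := by
    ext x
    rw [Set.mem_preimage, Set.mem_Icc, Set.mem_uIcc]
    rcases lt_or_gt_of_ne hvu with h | h
    · rw [le_div_iff_of_neg h, div_le_iff_of_neg h]
      constructor
      · rintro ⟨h1, h2⟩; right; constructor <;> linarith
      · rintro (⟨h1, h2⟩ | ⟨h1, h2⟩) <;> constructor <;> linarith
    · rw [le_div_iff₀ h, div_le_iff₀ h]
      constructor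
      · rintro ⟨h1, h2⟩; left; constructor <;> linarith
      · rintro (⟨h1, h2⟩ | ⟨h1, h2⟩) <;> constructor <;> linarith
  rw [lintegral_indicator_const hmeas, hset, Real.volume_interval, add_sub_cancel_left,
    ← ofReal_norm, hv, ENNReal.ofReal_one, one_mul, mul_comm]

/-- Cavalieri along lines parallel to `u`: a line over a point of the projection of `A` meets the
swept set in a unit segment, any other line misses it. Comparison with `sweptSet_measure` gives the
area factor without a change-of-variables formula. -/
theorem sweptSet_measure_eq_projection {A : Set E} (hA : MeasurableSet A) {v u : E} {d : ℝ}
    (hu : ‖u‖ = 1) (hvu : ⟪v, u⟫ ≠ 0) (hAd : ∀ a ∈ A, ⟪v, a⟫ = d) :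
    μHE[Module.finrank ℝ E] (sweptSet A v u d) =
      μHE[Module.finrank ℝ E - 1] ((ℝ ∙ u)ᗮ.starProjection '' A) := by
  have hu0 : u ≠ 0 := by rintro rfl; simp at hu
  have huu : ⟪u, u⟫ = 1 := by rw [real_inner_self_eq_norm_sq, hu, one_pow]
  have hr1 : Module.finrank ℝ (ℝ ∙ u) = 1 := finrank_span_singleton hu0
  have hr2 : Module.finrank ℝ (ℝ ∙ u)ᗮ = Module.finrank ℝ E - 1 := by
    have := (ℝ ∙ u).finrank_add_finrank_orthogonal
    omega
  rw [AffineSubspace.euclideanHausdorffMeasure_eq_lintegral (AffineSubspace.mk' (0 : E) (ℝ ∙ u)ᗮ)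
    (measurableSet_sweptSet hA v u d)]
  have hd1 : Module.finrank ℝ (AffineSubspace.mk' (0 : E) (ℝ ∙ u)ᗮ).directionᗮ = 1 := by
    rw [AffineSubspace.direction_mk', Submodule.orthogonal_orthogonal, hr1]
  have hd2 : Module.finrank ℝ (AffineSubspace.mk' (0 : E) (ℝ ∙ u)ᗮ).direction =
      Module.finrank ℝ E - 1 := by
    rw [AffineSubspace.direction_mk', hr2]
  rw [hd1, hd2, AffineSubspace.direction_mk', Submodule.orthogonal_orthogonal]
  have hmem : ∀ x y : E, y ∈ AffineSubspace.mk' x (ℝ ∙ u) ↔ ∃ t : ℝ, y = x + t • u := by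
    intro x y
    rw [AffineSubspace.mem_mk', Submodule.mem_span_singleton, vsub_eq_sub]
    exact exists_congr fun t => by rw [eq_sub_iff_add_eq, eq_comm, add_comm]
  have hs : ∀ x : AffineSubspace.mk' (0 : E) (ℝ ∙ u)ᗮ, ⟪u, (x : E)⟫ = 0 := by
    intro x
    have := x.2
    rw [AffineSubspace.mem_mk', Submodule.mem_orthogonal_singleton_iff_inner_right] at this
    simpa using this
  have hproj : ∀ x : AffineSubspace.mk' (0 : E) (ℝ ∙ u)ᗮ,
      (x : E) ∈ (ℝ ∙ u)ᗮ.starProjection '' A ↔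
        (x : E) + ((d - ⟪v, (x : E)⟫) / ⟪v, u⟫) • u ∈ A := by
    intro x
    constructor
    · rintro ⟨a, ha, hax⟩
      rw [starProjection_orthogonal_unit hu] at hax
      have h1 : (d - ⟪v, (x : E)⟫) / ⟪v, u⟫ = ⟪u, a⟫ := by
        rw [← hax, inner_sub_right, hAd a ha, real_inner_smul_right, sub_sub_cancel,
          mul_div_cancel_right₀ _ hvu]
      rw [h1, ← hax, sub_add_cancel]
      exact ha
    · intro h
      refine ⟨_, h, ?_⟩
      rw [starProjection_orthogonal_unit hu, inner_add_right, real_inner_smul_right, hs x, huu,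
        zero_add, mul_one, add_sub_cancel_right]
  have hmeas : MeasurableSet {x : AffineSubspace.mk' (0 : E) (ℝ ∙ u)ᗮ |
      (x : E) ∈ (ℝ ∙ u)ᗮ.starProjection '' A} := by
    simp_rw [hproj]
    have hc : Continuous fun x : AffineSubspace.mk' (0 : E) (ℝ ∙ u)ᗮ =>
        (x : E) + ((d - ⟪v, (x : E)⟫) / ⟪v, u⟫) • u := by fun_prop
    exact hc.measurable hA
  have hslice : ∀ x : AffineSubspace.mk' (0 : E) (ℝ ∙ u)ᗮ,
      μHE[1] (sweptSet A v u d ∩ AffineSubspace.mk' (x : E) (ℝ ∙ u)) =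
      {x : AffineSubspace.mk' (0 : E) (ℝ ∙ u)ᗮ |
        (x : E) ∈ (ℝ ∙ u)ᗮ.starProjection '' A}.indicator (fun _ => 1) x := by
    intro x
    have key : ∀ t : ℝ, (⟪v, (x : E) + t • u⟫ - d) / ⟪v, u⟫ =
        t - (d - ⟪v, (x : E)⟫) / ⟪v, u⟫ := by
      intro t
      rw [inner_add_right, real_inner_smul_right]
      field_simp
      ring
    by_cases hx : (x : E) ∈ (ℝ ∙ u)ᗮ.starProjection '' A
    · rw [Set.indicator_of_mem (by exact hx)]
      have hiso : Isometry fun t : ℝ => (x : E) + t • u := by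
        refine Isometry.of_dist_eq fun s t => ?_
        rw [dist_add_left, dist_eq_norm, ← sub_smul, norm_smul, hu, mul_one, Real.dist_eq,
          Real.norm_eq_abs]
      have himg : sweptSet A v u d ∩ AffineSubspace.mk' (x : E) (ℝ ∙ u) =
          (fun t : ℝ => (x : E) + t • u) '' Set.Icc ((d - ⟪v, (x : E)⟫) / ⟪v, u⟫)
            ((d - ⟪v, (x : E)⟫) / ⟪v, u⟫ + 1) := by
        ext y
        rw [Set.mem_inter_iff, SetLike.mem_coe, hmem, sweptSet, Set.mem_ofPred_eq]
        constructor
        · rintro ⟨⟨h1, -⟩, t, rfl⟩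
          rw [key, Set.mem_Icc] at h1
          exact ⟨t, ⟨by linarith [h1.1], by linarith [h1.2]⟩, rfl⟩
        · rintro ⟨t, ⟨h1, h2⟩, rfl⟩
          refine ⟨⟨?_, ?_⟩, t, rfl⟩
          · rw [key]; exact ⟨by linarith, by linarith⟩
          · rw [key, add_sub_assoc, ← sub_smul, sub_sub_cancel]
            exact (hproj x).mp hx
      have hvol : (μHE[1] : Measure ℝ) = volume := by
        have := InnerProductSpace.euclideanHausdorffMeasure_eq_volume (V := ℝ)
        rwa [Module.finrank_self] at this
      rw [himg, hiso.euclideanHausdorffMeasure_image, hvol, Real.volume_Icc, add_sub_cancel_left,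
        ENNReal.ofReal_one]
    · rw [Set.indicator_of_notMem (by exact hx)]
      convert measure_empty
      · rw [Set.eq_empty_iff_forall_notMem]
        rintro y ⟨⟨-, h⟩, hy⟩
        rw [SetLike.mem_coe, hmem] at hy
        obtain ⟨t, rfl⟩ := hy
        rw [key, add_sub_assoc, ← sub_smul, sub_sub_cancel] at h
        exact hx ((hproj x).mpr h)
      · infer_instance
  simp_rw [hslice]
  rw [lintegral_indicator_const hmeas, one_mul,
    ← AffineSubspace.euclideanHausdorffMeasure_coe_image]
  congr 1
  ext y
  constructor
  · rintro ⟨x, hx, rfl⟩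
    exact hx
  · rintro ⟨a, ha, rfl⟩
    refine ⟨⟨(ℝ ∙ u)ᗮ.starProjection a, ?_⟩, ⟨a, ha, rfl⟩, rfl⟩
    rw [AffineSubspace.mem_mk', vsub_eq_sub, sub_zero]
    exact Submodule.starProjection_apply_mem _ _

/-- Orthogonal projection onto `u^⊥` scales the area of subsets of a hyperplane with unit normal
`v` by `|⟪v, u⟫|`. -/
theorem euclideanHausdorffMeasure_starProjection_image {A : Set E} (hA : MeasurableSet A)
    {v u : E} {d : ℝ} (hv : ‖v‖ = 1) (hu : ‖u‖ = 1) (hvu : ⟪v, u⟫ ≠ 0)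
    (hAd : ∀ a ∈ A, ⟪v, a⟫ = d) :
    μHE[Module.finrank ℝ E - 1] ((ℝ ∙ u)ᗮ.starProjection '' A) =
      ENNReal.ofReal |⟪v, u⟫| * μHE[Module.finrank ℝ E - 1] A := by
  rw [← sweptSet_measure_eq_projection hA hu hvu hAd, sweptSet_measure hA hv hvu hAd]

end Projection

/-! ### Projected area of a polyhedron as a sum over facets -/

section Gauge

variable {n k : ℕ}

theorem unitBallVolume_pos (n : ℕ) : 0 < unitBallVolume n :=
  ENNReal.toReal_pos (measure_closedBall_pos volume _ one_pos).ne' measure_closedBall_lt_top.ne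

theorem volume_real_closedBall_zero (n : ℕ) {r : ℝ} (hr : 0 ≤ r) :
    volume.real (closedBall (0 : EuclideanSpace ℝ (Fin n)) r) = r ^ n * unitBallVolume n := by
  rw [unitBallVolume, measureReal_def, measureReal_def, Measure.addHaar_closedBall' _ _ hr,
    ENNReal.toReal_mul, ENNReal.toReal_ofReal (by positivity), finrank_euclideanSpace_fin]

/-- The projection of a ball onto `u^⊥` is a ball of one dimension less. -/
theorem euclideanHausdorffMeasure_starProjection_closedBall (hn : 1 ≤ n)
    {u : EuclideanSpace ℝ (Fin n)} (hu : ‖u‖ = 1) (x : EuclideanSpace ℝ (Fin n)) {r : ℝ}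
    (hr : 0 ≤ r) :
    μHE[n - 1] ((ℝ ∙ u)ᗮ.starProjection '' closedBall x r) =
      ENNReal.ofReal (r ^ (n - 1) * unitBallVolume (n - 1)) := by
  have hu0 : u ≠ 0 := by rintro rfl; simp at hu
  have hrank : Module.finrank ℝ (ℝ ∙ u)ᗮ = n - 1 := by
    have h1 := (ℝ ∙ u).finrank_add_finrank_orthogonal
    rw [finrank_span_singleton hu0, finrank_euclideanSpace_fin] at h1
    omega
  let b : OrthonormalBasis (Fin (n - 1)) ℝ (ℝ ∙ u)ᗮ :=
    (stdOrthonormalBasis ℝ (ℝ ∙ u)ᗮ).reindex (finCongr hrank)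
  have hiso : Isometry fun y : EuclideanSpace ℝ (Fin (n - 1)) =>
      ((b.repr.symm y : (ℝ ∙ u)ᗮ) : EuclideanSpace ℝ (Fin n)) :=
    isometry_subtype_coe.comp b.repr.symm.isometry
  have himg : (ℝ ∙ u)ᗮ.starProjection '' closedBall x r =
      (fun y : EuclideanSpace ℝ (Fin (n - 1)) =>
        ((b.repr.symm y : (ℝ ∙ u)ᗮ) : EuclideanSpace ℝ (Fin n))) ''
        closedBall (b.repr ((ℝ ∙ u)ᗮ.orthogonalProjectionOnto x)) r := by
    ext y
    constructor
    · rintro ⟨z, hz, rfl⟩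
      refine ⟨b.repr ((ℝ ∙ u)ᗮ.orthogonalProjectionOnto z), ?_, by simp⟩
      rw [mem_closedBall, b.repr.dist_map, dist_eq_norm, ← map_sub]
      rw [mem_closedBall, dist_eq_norm] at hz
      exact ((ℝ ∙ u)ᗮ.norm_orthogonalProjectionOnto_apply_le _).trans hz
    · rintro ⟨z, hz, rfl⟩
      -- The preimage keeps the component of `x` along `u`, so its distance to `x` is measured
      -- entirely in the hyperplane.
      refine ⟨x - (ℝ ∙ u)ᗮ.starProjection x + (b.repr.symm z : (ℝ ∙ u)ᗮ), ?_, ?_⟩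
      · rw [mem_closedBall, dist_eq_norm]
        rw [mem_closedBall, ← b.repr.symm.dist_map, b.repr.symm_apply_apply, dist_eq_norm,
          ← Submodule.norm_coe] at hz
        convert hz using 2
        rw [AddSubgroupClass.coe_sub, Submodule.coe_orthogonalProjectionOnto_apply]
        abel
      · rw [map_add, map_sub, Submodule.starProjection_eq_self_iff.mpr (Subtype.coe_prop _),
          Submodule.starProjection_eq_self_iff.mpr (Submodule.starProjection_apply_mem _ _),
          sub_self, zero_add]
  rw [himg, hiso.euclideanHausdorffMeasure_image,
    EuclideanSpace.euclideanHausdorffMeasure_eq_volume,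
    ← ENNReal.ofReal_toReal (measure_closedBall_lt_top (μ := volume)).ne,
    ← volume_real_closedBall_zero _ hr, measureReal_def, Measure.addHaar_closedBall_center]

theorem euclideanHausdorffMeasure_starProjection_lt_top (hn : 1 ≤ n)
    {u : EuclideanSpace ℝ (Fin n)} (hu : ‖u‖ = 1) {s : Set (EuclideanSpace ℝ (Fin n))}
    (hs : Bornology.IsBounded s) :
    μHE[n - 1] ((ℝ ∙ u)ᗮ.starProjection '' s) < ⊤ := by
  obtain ⟨R, hR⟩ := hs.subset_closedBall 0
  refine (measure_mono (Set.image_mono (hR.trans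
    (closedBall_subset_closedBall (le_abs_self R))))).trans_lt ?_
  rw [euclideanHausdorffMeasure_starProjection_closedBall hn hu 0 (abs_nonneg R)]
  exact ENNReal.ofReal_lt_top

theorem euclideanHausdorffMeasure_facetPiece_lt_top (hn : 1 ≤ n)
    {ν : Fin k → EuclideanSpace ℝ (Fin n)} {d : Fin k → ℝ} (hν : ∀ i, ‖ν i‖ = 1)
    (hb : Bornology.IsBounded (polyhedron ν d)) (i : Fin k) :
    μHE[n - 1] (facetPiece ν d i) < ⊤ := by
  have hνν : ⟪ν i, ν i⟫ = 1 := by rw [real_inner_self_eq_norm_sq, hν i, one_pow]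
  -- Projection along the facet's own normal preserves its area, so finiteness follows from that of
  -- projections of bounded sets.
  have h1 := euclideanHausdorffMeasure_starProjection_image (measurableSet_facetPiece ν d i)
    (hν i) (hν i) (hνν ▸ one_ne_zero) fun a ha => ha.2.1
  rw [hνν, finrank_euclideanSpace_fin, abs_one, ENNReal.ofReal_one, one_mul] at h1
  rw [← h1]
  exact euclideanHausdorffMeasure_starProjection_lt_top hn (hν i) (hb.subset fun x hx => hx.1)

/-- The function `x ↦ ∑ aᵢ ⟪νᵢ, x⟫₊`, where `aᵢ` is the area of the `i`-th facet of the polyhedron.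
On unit vectors it is the area of the projection of the polyhedron. -/
noncomputable def facetGauge (ν : Fin k → EuclideanSpace ℝ (Fin n)) (d : Fin k → ℝ)
    (x : EuclideanSpace ℝ (Fin n)) : ℝ :=
  ∑ i, (μHE[n - 1]).real (facetPiece ν d i) * max ⟪ν i, x⟫ 0

theorem sum_starProjection_facetPiece (hn : 1 ≤ n)
    {ν : Fin k → EuclideanSpace ℝ (Fin n)} {d : Fin k → ℝ} (hν : ∀ i, ‖ν i‖ = 1)
    (hb : Bornology.IsBounded (polyhedron ν d)) {u : EuclideanSpace ℝ (Fin n)} (hu : ‖u‖ = 1) :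
    ∑ i with 0 < ⟪ν i, u⟫, μHE[n - 1] ((ℝ ∙ u)ᗮ.starProjection '' facetPiece ν d i) =
      ENNReal.ofReal (facetGauge ν d u) := by
  rw [facetGauge, ENNReal.ofReal_sum_of_nonneg fun i _ => by positivity, Finset.sum_filter]
  refine Finset.sum_congr rfl fun i _ => ?_
  split_ifs with h
  · have h1 := euclideanHausdorffMeasure_starProjection_image (measurableSet_facetPiece ν d i)
      (hν i) hu h.ne' fun a ha => ha.2.1
    rw [finrank_euclideanSpace_fin] at h1
    rw [h1, abs_of_pos h, max_eq_left h.le, ENNReal.ofReal_mul measureReal_nonneg, mul_comm,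
      ofReal_measureReal (euclideanHausdorffMeasure_facetPiece_lt_top hn hν hb i).ne]
  · rw [max_eq_right (not_lt.mp h), mul_zero, ENNReal.ofReal_zero]

/-- A ray in direction `u` from an interior point leaves through a facet with `0 < ⟪ν i, u⟫`, so the
projections of these facets cover. Starting in the interior rules out exits through facets parallel
to `u`. -/
theorem starProjection_interior_polyhedron_le (hn : 1 ≤ n)
    {ν : Fin k → EuclideanSpace ℝ (Fin n)} {d : Fin k → ℝ} (hν : ∀ i, ‖ν i‖ = 1)
    (hb : Bornology.IsBounded (polyhedron ν d)) {u : EuclideanSpace ℝ (Fin n)} (hu : ‖u‖ = 1) :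
    μHE[n - 1] ((ℝ ∙ u)ᗮ.starProjection '' interior (polyhedron ν d)) ≤
      ENNReal.ofReal (facetGauge ν d u) := by
  have hν0 : ∀ i, ν i ≠ 0 := fun i h => by simpa [h] using hν i
  have hu0 : u ≠ 0 := by rintro rfl; simp at hu
  have huu : ⟪u, u⟫ = 1 := by rw [real_inner_self_eq_norm_sq, hu, one_pow]
  rw [← sum_starProjection_facetPiece hn hν hb hu]
  refine (measure_mono ?_).trans (measure_biUnion_finset_le _ _)
  rintro _ ⟨x, hx, rfl⟩
  obtain ⟨t, ht, hf⟩ := exists_nonneg_add_smul_mem_frontier hb (interior_subset hx) hu0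
  rw [frontier_polyhedron hν0, Set.mem_iUnion] at hf
  obtain ⟨i, hi⟩ := hf
  have h1 := (mem_interior_polyhedron hν0).mp hx i
  have h2 := hi.2.1
  rw [inner_add_right, real_inner_smul_right] at h2
  have h3 : 0 < ⟪ν i, u⟫ := by
    by_contra hcon
    have := mul_nonpos_of_nonneg_of_nonpos ht (not_lt.mp hcon)
    linarith
  simp only [Set.mem_iUnion, Finset.mem_filter, Finset.mem_univ, true_and]
  refine ⟨i, h3, _, hi, ?_⟩
  rw [starProjection_orthogonal_unit hu, starProjection_orthogonal_unit hu, inner_add_right,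
    real_inner_smul_right, huu, mul_one, add_smul]
  abel

/-- A line parallel to `u` leaves the polyhedron at only one point, so the facets facing `u` have
disjoint projections. -/
theorem le_starProjection_polyhedron (hn : 1 ≤ n)
    {ν : Fin k → EuclideanSpace ℝ (Fin n)} {d : Fin k → ℝ} (hν : ∀ i, ‖ν i‖ = 1)
    (hb : Bornology.IsBounded (polyhedron ν d)) {u : EuclideanSpace ℝ (Fin n)} (hu : ‖u‖ = 1) :
    ENNReal.ofReal (facetGauge ν d u) ≤
      μHE[n - 1] ((ℝ ∙ u)ᗮ.starProjection '' polyhedron ν d) := by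
  rw [← sum_starProjection_facetPiece hn hν hb hu, ← measure_biUnion_finset]
  · refine measure_mono ?_
    simp only [Set.iUnion_subset_iff]
    exact fun i _ => Set.image_mono fun x hx => hx.1
  · intro i hi j hj hij
    refine Set.disjoint_left.mpr ?_
    rintro _ ⟨a, ha, rfl⟩ ⟨b, hb, hab⟩
    rw [starProjection_orthogonal_unit hu, starProjection_orthogonal_unit hu] at hab
    simp only [Finset.coe_filter, Finset.mem_univ, true_and, Set.mem_ofPred_eq] at hi hj
    have hb' : b = a + (⟪u, b⟫ - ⟪u, a⟫) • u := by
      rw [sub_smul, ← add_sub_assoc, add_sub_right_comm, ← hab]; abel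
    generalize ⟪u, b⟫ - ⟪u, a⟫ = t at hb'
    have h1 := ha.1 j
    have h2 := hb.1 i
    have h3 := ha.2.1
    have h4 := hb.2.1
    rw [hb', inner_add_right, real_inner_smul_right] at h2 h4
    have ht : t = 0 := by
      rcases lt_trichotomy t 0 with h | h | h
      · have := mul_neg_of_neg_of_pos h hj; linarith
      · exact h
      · have := mul_pos h hi; linarith
    rw [ht, zero_smul, add_zero] at hb'
    subst hb'
    exact hij (facetPiece_eq_of_mem ha hb)
  · intro i hi
    simp only [Finset.mem_filter, Finset.mem_univ, true_and] at hi
    -- The projection is injective on a facet not parallel to `u`, so by Lusin–Souslin the image is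
    -- measurable.
    refine (measurableSet_facetPiece ν d i).image_of_continuousOn_injOn
      (ContinuousLinearMap.continuous _).continuousOn ?_
    intro a ha b hb hab
    rw [starProjection_orthogonal_unit hu, starProjection_orthogonal_unit hu] at hab
    have hb' : b = a + (⟪u, b⟫ - ⟪u, a⟫) • u := by
      rw [sub_smul, ← add_sub_assoc, add_sub_right_comm, hab]; abel
    generalize ⟪u, b⟫ - ⟪u, a⟫ = t at hb'
    have h3 := ha.2.1
    have h4 := hb.2.1
    rw [hb', inner_add_right, real_inner_smul_right, h3] at h4
    have ht : t = 0 := by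
      rcases mul_eq_zero.mp (by linarith : t * ⟪ν i, u⟫ = 0) with h | h
      · exact h
      · exact absurd h hi.ne'
    rw [hb', ht, zero_smul, add_zero]

theorem continuous_facetGauge (ν : Fin k → EuclideanSpace ℝ (Fin n)) (d : Fin k → ℝ) :
    Continuous (facetGauge ν d) := by
  unfold facetGauge
  fun_prop

theorem facetGauge_smul (ν : Fin k → EuclideanSpace ℝ (Fin n)) (d : Fin k → ℝ)
    {r : ℝ} (hr : 0 ≤ r) (x : EuclideanSpace ℝ (Fin n)) :
    facetGauge ν d (r • x) = r * facetGauge ν d x := by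
  simp only [facetGauge, Finset.mul_sum]
  refine Finset.sum_congr rfl fun i _ => ?_
  rw [real_inner_smul_right, ← mul_zero r, ← mul_max_of_nonneg _ _ hr, mul_zero]
  ring

end Gauge

/-! ### Polar coordinates and integrals over the sphere -/

section Sphere

variable {n : ℕ}

theorem unitBallVolume_eq (m : ℕ) :
    unitBallVolume m = Real.pi ^ (m / 2 : ℝ) / Real.Gamma (m / 2 + 1) := by
  -- Dimension zero is needed: it is the value of `n - 1` when `n = 1`.
  rcases Nat.eq_zero_or_pos m with rfl | hm
  · have h : closedBall (0 : EuclideanSpace ℝ (Fin 0)) 1 = {0} :=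
      Set.Subsingleton.eq_singleton_of_mem Set.subsingleton_of_subsingleton (by simp)
    rw [unitBallVolume, h, ← EuclideanSpace.euclideanHausdorffMeasure_eq_volume, measureReal_def]
    simp
  · have : Nonempty (Fin m) := ⟨⟨0, hm⟩⟩
    rw [unitBallVolume, measureReal_def, EuclideanSpace.volume_closedBall, ENNReal.ofReal_one,
      one_pow, one_mul, ENNReal.toReal_ofReal (by positivity), Fintype.card_fin,
      Real.sqrt_eq_rpow, ← Real.rpow_mul_natCast Real.pi_pos.le]
    congr 2
    ring

theorem integral_Ioi_pow_mul_exp_neg_sq (m : ℕ) :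
    ∫ r in Set.Ioi (0 : ℝ), r ^ m * Real.exp (-r ^ 2) = Real.Gamma ((m + 1) / 2) / 2 := by
  have h := integral_rpow_mul_exp_neg_rpow (p := 2) (q := m) two_pos
    (by have : (0 : ℝ) ≤ m := Nat.cast_nonneg m
        linarith)
  rw [one_div_mul_eq_div] at h
  rw [← h]
  refine setIntegral_congr_fun measurableSet_Ioi fun x _ => ?_
  simp only [← Real.rpow_natCast, Nat.cast_ofNat]

theorem integral_max_mul_exp_neg_sq :
    ∫ s : ℝ, max s 0 * Real.exp (-s ^ 2) = 1 / 2 := by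
  have h : (fun s : ℝ => max s 0 * Real.exp (-s ^ 2)) =
      (Set.Ioi 0).indicator fun s : ℝ => s ^ 1 * Real.exp (-s ^ 2) := by
    ext s
    by_cases hs : 0 < s
    · rw [Set.indicator_of_mem (by exact hs), max_eq_left hs.le, pow_one]
    · rw [Set.indicator_of_notMem (by exact hs), max_eq_right (not_lt.mp hs), zero_mul]
  rw [h, integral_indicator measurableSet_Ioi, integral_Ioi_pow_mul_exp_neg_sq]
  norm_num

/-- The Gaussian splits over `ℝ ∙ v` and its orthogonal complement, leaving a one-dimensional
half-line moment times a Gaussian integral in dimension `n - 1`. -/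
theorem integral_max_inner_mul_exp_neg_sq (hn : 1 ≤ n) {v : EuclideanSpace ℝ (Fin n)}
    (hv : ‖v‖ = 1) :
    ∫ x : EuclideanSpace ℝ (Fin n), max ⟪v, x⟫ 0 * Real.exp (-‖x‖ ^ 2) =
      Real.pi ^ (((n - 1 : ℕ) : ℝ) / 2) / 2 := by
  have hv0 : v ≠ 0 := by rintro rfl; simp at hv
  have hvv : ⟪v, v⟫ = 1 := by rw [real_inner_self_eq_norm_sq, hv, one_pow]
  have hrank : Module.finrank ℝ (ℝ ∙ v)ᗮ = n - 1 := by
    have h1 := (ℝ ∙ v).finrank_add_finrank_orthogonal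
    rw [finrank_span_singleton hv0, finrank_euclideanSpace_fin] at h1
    omega
  have hmp := (ℝ ∙ v).measurePreserving_measurableEquivProd (0 : EuclideanSpace ℝ (Fin n))
  rw [InnerProductSpace.euclideanHausdorffMeasure_eq_volume] at hmp
  have h1 := hmp.integral_comp' (fun p : (ℝ ∙ v) × (ℝ ∙ v)ᗮ =>
    (max ⟪v, (p.1 : EuclideanSpace ℝ (Fin n))⟫ 0 * Real.exp (-‖p.1‖ ^ 2)) *
      Real.exp (-‖p.2‖ ^ 2))
  rw [Measure.volume_eq_prod, integral_prod_mul
    (fun p : (ℝ ∙ v) => max ⟪v, (p : EuclideanSpace ℝ (Fin n))⟫ 0 * Real.exp (-‖p‖ ^ 2))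
    (fun p : (ℝ ∙ v)ᗮ => Real.exp (-‖p‖ ^ 2))] at h1
  have h2 := (LinearIsometryEquiv.toSpanUnitSingleton (𝕜 := ℝ) v hv).measurePreserving.integral_comp
    (LinearIsometryEquiv.toSpanUnitSingleton (𝕜 := ℝ) v hv).toHomeomorph.measurableEmbedding
    (fun p : (ℝ ∙ v) => max ⟪v, (p : EuclideanSpace ℝ (Fin n))⟫ 0 * Real.exp (-‖p‖ ^ 2))
  have h3 : ∫ p : (ℝ ∙ v)ᗮ, Real.exp (-‖p‖ ^ 2) = Real.pi ^ (((n - 1 : ℕ) : ℝ) / 2) := by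
    have := GaussianFourier.integral_rexp_neg_mul_sq_norm (V := (ℝ ∙ v)ᗮ) one_pos
    simp only [neg_mul, one_mul, div_one, hrank] at this
    exact this
  have h4 : ∫ p : (ℝ ∙ v), max ⟪v, (p : EuclideanSpace ℝ (Fin n))⟫ 0 * Real.exp (-‖p‖ ^ 2) =
      1 / 2 := by
    rw [← h2, ← integral_max_mul_exp_neg_sq]
    congr 1
    ext s
    rw [LinearIsometryEquiv.norm_map, LinearIsometryEquiv.toSpanUnitSingleton_apply,
      real_inner_smul_right, hvv, mul_one, Real.norm_eq_abs, sq_abs]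
  rw [h3, h4] at h1
  rw [div_eq_inv_mul, ← one_div, ← h1]
  congr 1
  ext x
  rw [Submodule.measurableEquivProd_apply, vsub_eq_sub, sub_zero,
    Submodule.norm_sq_eq_add_norm_sq_projection x (ℝ ∙ v), neg_add, Real.exp_add, mul_assoc]
  congr 2
  rw [Submodule.coe_orthogonalProjectionOnto_apply, Submodule.starProjection_unit_singleton ℝ hv,
    real_inner_smul_right, hvv, mul_one]

/-- The radial weight is `r ^ n`: `r ^ (n - 1)` from the polar Jacobian and one more factor from
homogeneity of `g`. With a Gaussian `f` it turns sphere integrals into integrals over the whole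
space. -/
theorem integral_eq_sphere_mul_radial (hn : 1 ≤ n) (g : EuclideanSpace ℝ (Fin n) → ℝ)
    (hg : ∀ (r : ℝ) (x : EuclideanSpace ℝ (Fin n)), 0 ≤ r → g (r • x) = r * g x) (f : ℝ → ℝ) :
    ∫ x : EuclideanSpace ℝ (Fin n), g x * f ‖x‖ =
      (∫ u : sphere (0 : EuclideanSpace ℝ (Fin n)) 1, g u
        ∂(volume : Measure (EuclideanSpace ℝ (Fin n))).toSphere) *
      ∫ r in Set.Ioi (0 : ℝ), r ^ n * f r := by
  have : Nonempty (Fin n) := ⟨⟨0, hn⟩⟩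
  have hF := (volume : Measure (EuclideanSpace ℝ (Fin n))).measurePreserving_homeomorphUnitSphereProd
    |>.integral_comp (Homeomorph.measurableEmbedding _)
    (fun p : sphere (0 : EuclideanSpace ℝ (Fin n)) 1 × Set.Ioi (0 : ℝ) =>
      g p.1 * ((p.2 : ℝ) * f p.2))
  rw [integral_prod_mul (fun u : sphere (0 : EuclideanSpace ℝ (Fin n)) 1 => g u)
    (fun r : Set.Ioi (0 : ℝ) => (r : ℝ) * f r)] at hF
  calc ∫ x : EuclideanSpace ℝ (Fin n), g x * f ‖x‖
      = ∫ x : ({(0 : EuclideanSpace ℝ (Fin n))}ᶜ : Set _), g x.1 * f ‖x.1‖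
          ∂(volume.comap Subtype.val) := by
        rw [integral_subtype_comap (measurableSet_singleton _).compl fun x => g x * f ‖x‖,
          restrict_compl_singleton]
    _ = _ := by
        rw [← integral_congr_ae (Filter.Eventually.of_forall fun x => ?_), hF]
        · congr 1
          simp only [Measure.volumeIoiPow, ENNReal.ofReal]
          rw [integral_withDensity_eq_integral_smul,
            integral_subtype_comap measurableSet_Ioi fun a =>
              Real.toNNReal (a ^ (Module.finrank ℝ (EuclideanSpace ℝ (Fin n)) - 1)) • (a * f a),
            setIntegral_congr_fun measurableSet_Ioi fun x hx => ?_]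
          · rw [NNReal.smul_def, Real.coe_toNNReal _ (pow_nonneg hx.out.le _), smul_eq_mul,
              finrank_euclideanSpace_fin, ← mul_assoc, ← pow_succ, Nat.sub_add_cancel hn]
          · exact (measurable_subtype_coe.pow_const _).real_toNNReal
        · have hx : 0 < ‖x.1‖ := norm_pos_iff.mpr x.2
          have h1 : g x.1 = ‖x.1‖ * g (‖x.1‖⁻¹ • x.1) := by
            rw [hg _ _ (inv_nonneg.mpr hx.le), mul_inv_cancel_left₀ hx.ne']
          simp only [homeomorphUnitSphereProd_apply_snd_coe, homeomorphUnitSphereProd_apply_fst_coe]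
          rw [h1]
          ring

/-- The mean of `⟪v, u⟫₊` over the unit sphere, up to normalization. -/
theorem integral_sphere_max_inner (hn : 1 ≤ n) {v : EuclideanSpace ℝ (Fin n)} (hv : ‖v‖ = 1) :
    ∫ u : sphere (0 : EuclideanSpace ℝ (Fin n)) 1, max ⟪v, (u : EuclideanSpace ℝ (Fin n))⟫ 0
      ∂(volume : Measure (EuclideanSpace ℝ (Fin n))).toSphere = unitBallVolume (n - 1) := by
  have h := integral_eq_sphere_mul_radial hn (fun x => max ⟪v, x⟫ 0) (fun r x hr => by
    rw [real_inner_smul_right, mul_max_of_nonneg _ _ hr, mul_zero]) fun r => Real.exp (-r ^ 2)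
  rw [integral_max_inner_mul_exp_neg_sq hn hv, integral_Ioi_pow_mul_exp_neg_sq] at h
  have hG : (((n - 1 : ℕ) : ℝ) / 2 + 1) = ((n : ℝ) + 1) / 2 := by
    rw [Nat.cast_sub hn, Nat.cast_one]; ring
  have hpos : 0 < Real.Gamma (((n : ℝ) + 1) / 2) := Real.Gamma_pos_of_pos (by positivity)
  rw [unitBallVolume_eq, hG, eq_div_iff hpos.ne']
  linarith

theorem toSphere_real_univ (n : ℕ) :
    (volume : Measure (EuclideanSpace ℝ (Fin n))).toSphere.real Set.univ =
      n * unitBallVolume n := by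
  rcases Nat.eq_zero_or_pos n with rfl | hn
  · simp
  · have : Nonempty (Fin n) := ⟨⟨0, hn⟩⟩
    rw [Measure.toSphere_real_apply_univ, finrank_euclideanSpace_fin, unitBallVolume,
      measureReal_def, measureReal_def, Measure.addHaar_closedBall_eq_addHaar_ball]

/-- The sublevel set `{g ≤ 1}` of a positively homogeneous function `g` has at least the volume of
the ball on which the average of `g` equals `1`. -/
theorem unitBallVolume_le_of_homogeneous (hn : 1 ≤ n) {g : EuclideanSpace ℝ (Fin n) → ℝ}
    (hgc : Continuous g)
    (hg : ∀ (r : ℝ) (x : EuclideanSpace ℝ (Fin n)), 0 ≤ r → g (r • x) = r * g x)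
    (hpos : ∀ u : EuclideanSpace ℝ (Fin n), ‖u‖ = 1 → 0 < g u) {m : ℝ} (hm : 0 < m)
    (hgm : ∫ u : sphere (0 : EuclideanSpace ℝ (Fin n)) 1, g u
        ∂(volume : Measure (EuclideanSpace ℝ (Fin n))).toSphere ≤ n * unitBallVolume n * m) :
    ENNReal.ofReal (unitBallVolume n * m⁻¹ ^ n) ≤ volume {x | g x ≤ 1} := by
  set σ := (volume : Measure (EuclideanSpace ℝ (Fin n))).toSphere with hσ
  have : Nonempty (Fin n) := ⟨⟨0, hn⟩⟩
  have hn0 : (0 : ℝ) < n := by exact_mod_cast hn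
  have hpos' : ∀ u : sphere (0 : EuclideanSpace ℝ (Fin n)) 1, 0 < g u := fun u =>
    hpos u (by simp)
  have hcont : Continuous fun u : sphere (0 : EuclideanSpace ℝ (Fin n)) 1 =>
      (g u)⁻¹ ^ n / n := by
    have : Continuous fun u : sphere (0 : EuclideanSpace ℝ (Fin n)) 1 => g u := by fun_prop
    exact ((this.inv₀ fun u => (hpos' u).ne').pow n).div_const _
  have hint : Integrable (fun u : sphere (0 : EuclideanSpace ℝ (Fin n)) 1 => (g u)⁻¹ ^ n / n) σ :=
    hcont.integrable_of_hasCompactSupport (HasCompactSupport.of_compactSpace _)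
  have hgint : Integrable (fun u : sphere (0 : EuclideanSpace ℝ (Fin n)) 1 => g u) σ :=
    Continuous.integrable_of_hasCompactSupport (by fun_prop) (HasCompactSupport.of_compactSpace _)
  have hclosed : IsClosed {x | g x ≤ 1} := isClosed_le hgc continuous_const
  have hmp := (volume : Measure (EuclideanSpace ℝ (Fin n))).measurePreserving_homeomorphUnitSphereProd
  let T : Set (sphere (0 : EuclideanSpace ℝ (Fin n)) 1 × Set.Ioi (0 : ℝ)) :=
    {p | g p.1 * p.2 ≤ 1}
  have hT : MeasurableSet T := (isClosed_le (by fun_prop) continuous_const).measurableSet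
  have hvol : volume {x | g x ≤ 1} =
      (σ.prod (Measure.volumeIoiPow (Module.finrank ℝ (EuclideanSpace ℝ (Fin n)) - 1))) T := by
    rw [← hmp.measure_preimage_emb (Homeomorph.measurableEmbedding _),
      (MeasurableEmbedding.subtype_coe (measurableSet_singleton _).compl).comap_apply]
    have himg : Subtype.val '' (homeomorphUnitSphereProd (EuclideanSpace ℝ (Fin n)) ⁻¹' T) =
        {x | g x ≤ 1} \ {0} := by
      ext x
      have key : ∀ hx : x ≠ 0, g (‖x‖⁻¹ • x) * ‖x‖ = g x := by
        intro hx
        have hx' : 0 < ‖x‖ := norm_pos_iff.mpr hx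
        rw [hg _ _ (inv_nonneg.mpr hx'.le), mul_comm, mul_inv_cancel_left₀ hx'.ne']
      constructor
      · rintro ⟨⟨y, hy⟩, hyT, rfl⟩
        refine ⟨?_, hy⟩
        have h1 : g (homeomorphUnitSphereProd (EuclideanSpace ℝ (Fin n)) ⟨y, hy⟩).1 *
          (homeomorphUnitSphereProd (EuclideanSpace ℝ (Fin n)) ⟨y, hy⟩).2 ≤ 1 := hyT
        simp only [homeomorphUnitSphereProd_apply_snd_coe,
          homeomorphUnitSphereProd_apply_fst_coe] at h1
        rwa [key hy] at h1
      · rintro ⟨hx1, hx0⟩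
        refine ⟨⟨x, hx0⟩, ?_, rfl⟩
        change g (homeomorphUnitSphereProd (EuclideanSpace ℝ (Fin n)) ⟨x, hx0⟩).1 *
          (homeomorphUnitSphereProd (EuclideanSpace ℝ (Fin n)) ⟨x, hx0⟩).2 ≤ 1
        simp only [homeomorphUnitSphereProd_apply_snd_coe, homeomorphUnitSphereProd_apply_fst_coe]
        rw [key hx0]
        exact hx1
    rw [himg, measure_sdiff_null (measure_singleton _)]
  rw [hvol, Measure.prod_apply hT]
  -- The radial section over `u` contains the interval `(0, 1 / g u)`, whose measure for `r ^ (n -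
  -- 1) dr` is `(g u)⁻¹ ^ n / n`.
  have hsec : ∀ u : sphere (0 : EuclideanSpace ℝ (Fin n)) 1, ENNReal.ofReal ((g u)⁻¹ ^ n / n) ≤
      Measure.volumeIoiPow (Module.finrank ℝ (EuclideanSpace ℝ (Fin n)) - 1)
        (Prod.mk u ⁻¹' T) := by
    intro u
    have h1 := Measure.volumeIoiPow_apply_Iio
      (Module.finrank ℝ (EuclideanSpace ℝ (Fin n)) - 1) ⟨(g u)⁻¹, inv_pos.mpr (hpos' u)⟩
    have h2 : Module.finrank ℝ (EuclideanSpace ℝ (Fin n)) - 1 + 1 = n := by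
      rw [finrank_euclideanSpace_fin, Nat.sub_add_cancel hn]
    have h3 : ((Module.finrank ℝ (EuclideanSpace ℝ (Fin n)) - 1 : ℕ) : ℝ) + 1 = n := by
      exact_mod_cast h2
    rw [h2, h3] at h1
    rw [← h1]
    refine measure_mono fun r hr => ?_
    have hr' : (r : ℝ) < (g u)⁻¹ := hr
    change g u * r ≤ 1
    calc g u * r ≤ g u * (g u)⁻¹ := mul_le_mul_of_nonneg_left hr'.le (hpos' u).le
      _ = 1 := mul_inv_cancel₀ (hpos' u).ne'
  refine le_trans ?_ (lintegral_mono hsec)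
  rw [← ofReal_integral_eq_lintegral_ofReal hint (Filter.Eventually.of_forall fun u => by
    have := hpos' u
    positivity)]
  refine ENNReal.ofReal_le_ofReal ?_
  -- Jensen by hand: the left side is the tangent line at `t = m` to the convex function `t⁻¹ ^ n /
  -- n`, evaluated at `t = g u`. It follows from Bernoulli's inequality and `m / t + t / m ≥ 2`.
  have htan : ∀ u : sphere (0 : EuclideanSpace ℝ (Fin n)) 1,
      m⁻¹ ^ n / n * (1 + n) - m⁻¹ ^ n * m⁻¹ * g u ≤ (g u)⁻¹ ^ n / n := by
    intro u
    have hgu := hpos' u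
    have h1 : 1 + (n : ℝ) * (m / g u - 1) ≤ (1 + (m / g u - 1)) ^ n :=
      one_add_mul_le_pow (by have : 0 < m / g u := by positivity
                             linarith) n
    have h2 : 1 - g u / m ≤ m / g u - 1 := by
      have : 0 ≤ (m - g u) ^ 2 / (m * g u) := by positivity
      have h3 : (m - g u) ^ 2 / (m * g u) = m / g u + g u / m - 2 := by field_simp; ring
      linarith
    have h3 : (1 + n) - n * (g u / m) ≤ (m / g u) ^ n := by
      rw [add_sub_cancel] at h1
      have := mul_le_mul_of_nonneg_left h2 hn0.le
      linarith
    have h4 : (g u)⁻¹ ^ n / n = m⁻¹ ^ n / n * (m / g u) ^ n := by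
      rw [div_mul_eq_mul_div, ← mul_pow, inv_mul_eq_div, div_div, mul_comm (g u) m,
        div_mul_cancel_left₀ hm.ne']
    rw [h4]
    refine le_trans (le_of_eq ?_) (mul_le_mul_of_nonneg_left h3 (by positivity))
    field_simp
  have hmono := integral_mono (((integrable_const _).sub (hgint.const_mul _))) hint htan
  refine le_trans ?_ hmono
  have hcm := integral_sub (μ := σ) (integrable_const (m⁻¹ ^ n / n * (1 + n)))
    (hgint.const_mul (m⁻¹ ^ n * m⁻¹))
  rw [integral_const, integral_const_mul, smul_eq_mul, hσ, toSphere_real_univ, ← hσ] at hcm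
  refine le_trans ?_ hcm.ge
  have h5 := mul_le_mul_of_nonneg_left hgm (by positivity : 0 ≤ m⁻¹ ^ n * m⁻¹)
  have h6 : m⁻¹ ^ n * m⁻¹ * (n * unitBallVolume n * m) = m⁻¹ ^ n * (n * unitBallVolume n) := by
    field_simp
  have h7 : n * unitBallVolume n * (m⁻¹ ^ n / n * (1 + n)) =
      unitBallVolume n * m⁻¹ ^ n * (1 + n) := by
    field_simp
  rw [h6] at h5
  rw [h7]
  linarith

end Sphere

/-! ### Cauchy's formula and the polar projection body -/

section PolarProjection

variable {n k : ℕ}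

theorem surfaceArea_polyhedron (hn : 1 ≤ n) {ν : Fin k → EuclideanSpace ℝ (Fin n)}
    {d : Fin k → ℝ} (hν : ∀ i, ‖ν i‖ = 1) (hb : Bornology.IsBounded (polyhedron ν d)) :
    surfaceArea (polyhedron ν d) = ∑ i, (μHE[n - 1]).real (facetPiece ν d i) := by
  rw [surfaceArea, measureReal_def, euclideanHausdorffMeasure_frontier_polyhedron _
    fun i h => by simpa [h] using hν i, ENNReal.toReal_sum fun i _ =>
    (euclideanHausdorffMeasure_facetPiece_lt_top hn hν hb i).ne]
  rfl

theorem euclideanHausdorffMeasure_frontier_polyhedron_lt_top (hn : 1 ≤ n)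
    {ν : Fin k → EuclideanSpace ℝ (Fin n)} {d : Fin k → ℝ} (hν : ∀ i, ‖ν i‖ = 1)
    (hb : Bornology.IsBounded (polyhedron ν d)) :
    μHE[n - 1] (frontier (polyhedron ν d)) < ⊤ := by
  rw [euclideanHausdorffMeasure_frontier_polyhedron _ fun i h => by simpa [h] using hν i]
  exact ENNReal.sum_lt_top.mpr fun i _ => euclideanHausdorffMeasure_facetPiece_lt_top hn hν hb i

/-- Cauchy's surface area formula for polyhedra. -/
theorem integral_facetGauge (hn : 1 ≤ n) {ν : Fin k → EuclideanSpace ℝ (Fin n)}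
    {d : Fin k → ℝ} (hν : ∀ i, ‖ν i‖ = 1) (hb : Bornology.IsBounded (polyhedron ν d)) :
    ∫ u : sphere (0 : EuclideanSpace ℝ (Fin n)) 1, facetGauge ν d u
      ∂(volume : Measure (EuclideanSpace ℝ (Fin n))).toSphere =
      unitBallVolume (n - 1) * surfaceArea (polyhedron ν d) := by
  have : Nonempty (Fin n) := ⟨⟨0, hn⟩⟩
  rw [surfaceArea_polyhedron hn hν hb, mul_comm, Finset.sum_mul]
  simp only [facetGauge]
  rw [integral_finsetSum]
  · refine Finset.sum_congr rfl fun i _ => ?_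
    rw [integral_const_mul, integral_sphere_max_inner hn (hν i)]
  · exact fun i _ => Continuous.integrable_of_hasCompactSupport (by fun_prop)
      (HasCompactSupport.of_compactSpace _)

/-- The boundary of a convex body has finite area. -/
theorem euclideanHausdorffMeasure_frontier_lt_top (hn : 1 ≤ n)
    {K : Set (EuclideanSpace ℝ (Fin n))} (hK : Convex ℝ K) (hKc : IsCompact K)
    (hint : (interior K).Nonempty) : μHE[n - 1] (frontier K) < ⊤ := by
  obtain ⟨R, hR⟩ := hKc.isBounded.subset_closedBall 0
  obtain ⟨x, hx⟩ := id hint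
  obtain ⟨k, ν, d, hν, h1, h2⟩ := exists_polyhedron_between hK hKc ⟨x, interior_subset hx⟩
    (isCompact_closedBall (0 : EuclideanSpace ℝ (Fin n)) (R + 1))
    (hR.trans ((closedBall_subset_ball (lt_add_one R)).trans ball_subset_interior_closedBall))
  have hb : Bornology.IsBounded (polyhedron ν d) := isBounded_closedBall.subset h2
  exact (hK.euclideanHausdorffMeasure_frontier_le (n - 1) hKc.isClosed hint hb
    (h1.trans interior_subset)).trans_lt
    (euclideanHausdorffMeasure_frontier_polyhedron_lt_top hn hν hb)

/-- Surface area is monotone on convex bodies. -/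
theorem surfaceArea_mono (hn : 1 ≤ n) {K L : Set (EuclideanSpace ℝ (Fin n))} (hK : Convex ℝ K)
    (hKc : IsClosed K) (hint : (interior K).Nonempty) (hL : Convex ℝ L) (hLc : IsCompact L)
    (hKL : K ⊆ L) : surfaceArea K ≤ surfaceArea L :=
  ENNReal.toReal_mono
    (euclideanHausdorffMeasure_frontier_lt_top hn hL hLc (hint.mono (interior_mono hKL))).ne
    (hK.euclideanHausdorffMeasure_frontier_le (n - 1) hKc hint hLc.isBounded hKL)

theorem projectionVolume_closedBall (hn : 1 ≤ n) {u : EuclideanSpace ℝ (Fin n)} (hu : ‖u‖ = 1)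
    (x : EuclideanSpace ℝ (Fin n)) {r : ℝ} (hr : 0 ≤ r) :
    projectionVolume (closedBall x r) u = r ^ (n - 1) * unitBallVolume (n - 1) := by
  have := unitBallVolume_pos (n - 1)
  rw [projectionVolume, measureReal_def,
    euclideanHausdorffMeasure_starProjection_closedBall hn hu x hr,
    ENNReal.toReal_ofReal (by positivity)]

theorem projectionVolume_mono (hn : 1 ≤ n) {u : EuclideanSpace ℝ (Fin n)} (hu : ‖u‖ = 1)
    {K L : Set (EuclideanSpace ℝ (Fin n))} (hL : Bornology.IsBounded L) (hKL : K ⊆ L) :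
    projectionVolume K u ≤ projectionVolume L u :=
  ENNReal.toReal_mono (euclideanHausdorffMeasure_starProjection_lt_top hn hu hL).ne
    (measure_mono (Set.image_mono hKL))

theorem projectionVolume_homothety (K : Set (EuclideanSpace ℝ (Fin n)))
    (u x : EuclideanSpace ℝ (Fin n)) {c : ℝ} (hc : 0 < c) :
    projectionVolume (AffineMap.homothety x c '' K) u = c ^ (n - 1) * projectionVolume K u := by
  have himg : (ℝ ∙ u)ᗮ.starProjection '' (AffineMap.homothety x c '' K) =
      AffineMap.homothety ((ℝ ∙ u)ᗮ.starProjection x) c '' ((ℝ ∙ u)ᗮ.starProjection '' K) := by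
    rw [Set.image_image, Set.image_image]
    refine Set.image_congr fun y _ => ?_
    simp only [AffineMap.homothety_apply, vsub_eq_sub, vadd_eq_add, map_add, map_smul, map_sub]
  rw [projectionVolume, projectionVolume, himg, measureReal_def, measureReal_def,
    euclideanHausdorffMeasure_homothety_image _ _ hc.ne', ENNReal.smul_def, smul_eq_mul,
    ENNReal.toReal_mul, ENNReal.coe_toReal, NNReal.coe_pow, coe_nnnorm, Real.norm_of_nonneg hc.le]

/-- Compare with a ball inside `K`. The bound keeps `Π° K` bounded, so that its real-valued volume
is meaningful. -/
theorem exists_projectionVolume_lower_bound (hn : 1 ≤ n) {K : Set (EuclideanSpace ℝ (Fin n))}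
    (hKc : IsCompact K) (hint : (interior K).Nonempty) :
    ∃ ρ : ℝ, 0 < ρ ∧ ∀ u : EuclideanSpace ℝ (Fin n), ‖u‖ = 1 → ρ ≤ projectionVolume K u := by
  obtain ⟨x, hx⟩ := hint
  obtain ⟨r, hr, hball⟩ := nhds_basis_closedBall.mem_iff.mp (mem_interior_iff_mem_nhds.mp hx)
  have := unitBallVolume_pos (n - 1)
  refine ⟨r ^ (n - 1) * unitBallVolume (n - 1), by positivity, fun u hu => ?_⟩
  rw [← projectionVolume_closedBall hn hu x hr.le]
  exact projectionVolume_mono hn hu hKc.isBounded hball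

theorem polarProjectionBody_subset_closedBall {K : Set (EuclideanSpace ℝ (Fin n))} {ρ : ℝ}
    (hρ : 0 < ρ)
    (hK : ∀ u : EuclideanSpace ℝ (Fin n), ‖u‖ = 1 → ρ ≤ projectionVolume K u) :
    polarProjectionBody K ⊆ closedBall 0 ρ⁻¹ := by
  intro x hx
  rw [mem_closedBall_zero_iff]
  rcases eq_or_ne x 0 with rfl | hx0
  · rw [norm_zero]; positivity
  have hx' : 0 < ‖x‖ := norm_pos_iff.mpr hx0
  -- `Π K` contains the ball of radius `ρ`; the polar condition is tested at its point in the
  -- direction of `x`.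
  have hmem : (ρ * ‖x‖⁻¹) • x ∈ projectionBody K := by
    intro u hu
    refine le_trans ?_ (hK u hu)
    refine (real_inner_le_norm _ _).trans ?_
    rw [hu, one_mul, norm_smul, Real.norm_of_nonneg (by positivity), mul_assoc,
      inv_mul_cancel₀ hx'.ne', mul_one]
  have h := hx _ hmem
  rw [real_inner_smul_right, real_inner_self_eq_norm_sq, sq, mul_assoc,
    inv_mul_cancel_left₀ hx'.ne'] at h
  rwa [le_inv_comm₀ hx' hρ, ← one_div, le_div_iff₀ hx']

/-- This uses only the inequalities defining `Π K`; that projected area is itself a support function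
is never needed. -/
theorem mem_polarProjectionBody {K : Set (EuclideanSpace ℝ (Fin n))}
    {x : EuclideanSpace ℝ (Fin n)}
    (hx : ∀ u : EuclideanSpace ℝ (Fin n), ‖u‖ = 1 → x = ‖x‖ • u →
      ‖x‖ * projectionVolume K u ≤ 1) : x ∈ polarProjectionBody K := by
  intro y hy
  rcases eq_or_ne x 0 with rfl | hx0
  · rw [inner_zero_left]; exact zero_le_one
  have hx' : 0 < ‖x‖ := norm_pos_iff.mpr hx0
  have hu : ‖‖x‖⁻¹ • x‖ = 1 := by
    rw [norm_smul, norm_inv, norm_norm, inv_mul_cancel₀ hx'.ne']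
  have hxu : x = ‖x‖ • (‖x‖⁻¹ • x) := by rw [smul_inv_smul₀ hx'.ne']
  calc ⟪x, y⟫ = ‖x‖ * ⟪‖x‖⁻¹ • x, y⟫ := by rw [← real_inner_smul_left, ← hxu]
    _ ≤ ‖x‖ * projectionVolume K (‖x‖⁻¹ • x) := mul_le_mul_of_nonneg_left (hy _ hu) hx'.le
    _ ≤ 1 := hx _ hu hxu

theorem Convex.homothety_image_subset_interior {K : Set (EuclideanSpace ℝ (Fin n))}
    (hK : Convex ℝ K) {x : EuclideanSpace ℝ (Fin n)} (hx : x ∈ interior K) {c : ℝ} (hc0 : 0 ≤ c)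
    (hc1 : c < 1) : AffineMap.homothety x c '' K ⊆ interior K := by
  rintro _ ⟨y, hy, rfl⟩
  have h := hK.combo_interior_self_mem_interior hx hy (sub_pos.mpr hc1) hc0 (by ring)
  convert h using 1
  rw [AffineMap.homothety_apply, vsub_eq_sub, vadd_eq_add, smul_sub, sub_smul, one_smul]
  abel

/-- The polyhedron between the shrunken copy and `K` supplies both estimates: large projections and
small surface area. -/
theorem le_surfaceArea_pow_mul_of_lt_one (hn : 1 ≤ n) {K : Set (EuclideanSpace ℝ (Fin n))}
    (hK : Convex ℝ K) (hKc : IsCompact K) (hint : (interior K).Nonempty) {c : ℝ} (hc0 : 0 < c)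
    (hc1 : c < 1) :
    (c ^ (n - 1)) ^ n *
      (unitBallVolume n * (n * unitBallVolume n / unitBallVolume (n - 1)) ^ n) ≤
      surfaceArea K ^ n * volume.real (polarProjectionBody K) := by
  have hw := unitBallVolume_pos n
  have hw' := unitBallVolume_pos (n - 1)
  have hn0 : (0 : ℝ) < n := by exact_mod_cast hn
  obtain ⟨ρ, hρ, hρK⟩ := exists_projectionVolume_lower_bound hn hKc hint
  have hVfin : volume (polarProjectionBody K) ≠ ⊤ :=
    (isBounded_closedBall.subset (polarProjectionBody_subset_closedBall hρ hρK)).measure_lt_top.ne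
  obtain ⟨x, hx⟩ := id hint
  have hhom : Continuous (AffineMap.homothety x c : EuclideanSpace ℝ (Fin n) → _) :=
    AffineMap.homothety_continuous x c
  obtain ⟨k, ν, d, hν, h1, h2⟩ := exists_polyhedron_between
    (hK.affine_image (AffineMap.homothety x c)) (hKc.image hhom)
    (Set.Nonempty.image _ ⟨x, interior_subset hx⟩) hKc
    (hK.homothety_image_subset_interior hx hc0.le hc1)
  have hb : Bornology.IsBounded (polyhedron ν d) := hKc.isBounded.subset h2
  have hPint : (interior (polyhedron ν d)).Nonempty :=
    (Set.Nonempty.image _ ⟨x, interior_subset hx⟩).mono h1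
  have hle : ∀ u : EuclideanSpace ℝ (Fin n), ‖u‖ = 1 →
      c ^ (n - 1) * projectionVolume K u ≤ facetGauge ν d u := by
    intro u hu
    rw [← projectionVolume_homothety K u x hc0]
    refine ENNReal.toReal_le_of_le_ofReal ?_ ((measure_mono (Set.image_mono h1)).trans
      (starProjection_interior_polyhedron_le hn hν hb hu))
    rw [facetGauge]
    positivity
  have hgpos : ∀ u : EuclideanSpace ℝ (Fin n), ‖u‖ = 1 → 0 < facetGauge ν d u := fun u hu =>
    lt_of_lt_of_le (mul_pos (pow_pos hc0 _) (hρ.trans_le (hρK u hu))) (hle u hu)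
  have hSP : surfaceArea (polyhedron ν d) ≤ surfaceArea K :=
    surfaceArea_mono hn (convex_polyhedron ν d) (isClosed_polyhedron ν d) hPint hK hKc h2
  have hS : 0 < surfaceArea K := by
    refine lt_of_lt_of_le ?_ hSP
    refine lt_of_le_of_ne measureReal_nonneg fun h0 => ?_
    rw [surfaceArea_polyhedron hn hν hb, eq_comm,
      Finset.sum_eq_zero_iff_of_nonneg fun i _ => measureReal_nonneg] at h0
    -- Any unit vector serves: if all facets had zero area, the gauge would vanish, although it is
    -- positive on the sphere.
    have h3 := hgpos (EuclideanSpace.single (⟨0, hn⟩ : Fin n) 1) (by simp)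
    rw [facetGauge, Finset.sum_eq_zero fun i hi => by rw [h0 i hi, zero_mul]] at h3
    exact lt_irrefl _ h3
  have hcn : 0 < c ^ (n - 1) := pow_pos hc0 _
  -- The factor `(c ^ (n - 1))⁻¹` makes the gauge dominate the projected area of `K`, so its
  -- sublevel set lies in `Π° K`. The value `m` bounds its mean by Cauchy's formula and `hSP`.
  have hmain := unitBallVolume_le_of_homogeneous hn
    (g := fun x => (c ^ (n - 1))⁻¹ * facetGauge ν d x)
    (continuous_const.mul (continuous_facetGauge ν d))
    (fun r x hr => by rw [facetGauge_smul ν d hr]; ring)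
    (fun u hu => mul_pos (inv_pos.mpr hcn) (hgpos u hu))
    (m := (c ^ (n - 1))⁻¹ * (unitBallVolume (n - 1) * surfaceArea K) / (n * unitBallVolume n))
    (by positivity)
    (by
      rw [integral_const_mul, integral_facetGauge hn hν hb, mul_div_cancel₀ _ (by positivity)]
      gcongr)
  have hsub : {x | (c ^ (n - 1))⁻¹ * facetGauge ν d x ≤ 1} ⊆ polarProjectionBody K := by
    intro y hy
    refine mem_polarProjectionBody fun u hu hyu => ?_
    refine le_trans ?_ (show (c ^ (n - 1))⁻¹ * facetGauge ν d y ≤ 1 from hy)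
    have h3 : facetGauge ν d y = ‖y‖ * facetGauge ν d u := by
      conv_lhs => rw [hyu]
      exact facetGauge_smul ν d (norm_nonneg y) u
    rw [h3, mul_left_comm]
    refine mul_le_mul_of_nonneg_left ?_ (norm_nonneg y)
    rw [le_inv_mul_iff₀ hcn]
    exact hle u hu
  have hV : unitBallVolume n *
      ((c ^ (n - 1))⁻¹ * (unitBallVolume (n - 1) * surfaceArea K) / (n * unitBallVolume n))⁻¹ ^ n ≤
      volume.real (polarProjectionBody K) :=
    (ENNReal.ofReal_le_iff_le_toReal hVfin).mp (hmain.trans (measure_mono hsub))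
  refine le_trans (le_of_eq ?_) (mul_le_mul_of_nonneg_left hV (pow_nonneg hS.le n))
  rw [mul_left_comm, ← mul_pow, mul_left_comm, ← mul_pow]
  congr 2
  field_simp

theorem le_surfaceArea_pow_mul (hn : 1 ≤ n) {K : Set (EuclideanSpace ℝ (Fin n))}
    (hK : Convex ℝ K) (hKc : IsCompact K) (hint : (interior K).Nonempty) :
    unitBallVolume n * (n * unitBallVolume n / unitBallVolume (n - 1)) ^ n ≤
      surfaceArea K ^ n * volume.real (polarProjectionBody K) := by
  have hcont : Continuous fun c : ℝ => (c ^ (n - 1)) ^ n *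
      (unitBallVolume n * (n * unitBallVolume n / unitBallVolume (n - 1)) ^ n) := by fun_prop
  have ht := (hcont.tendsto 1).mono_left (nhdsWithin_le_nhds (s := Set.Iio 1))
  simp only [one_pow, one_mul] at ht
  refine le_of_tendsto ht ?_
  filter_upwards [Ioo_mem_nhdsLT (zero_lt_one (α := ℝ))] with c hc
  exact le_surfaceArea_pow_mul_of_lt_one hn hK hKc hint hc.1 hc.2

/-- A polyhedron between the unit ball and the ball of radius `c > 1` has projections of area at
most `c ^ (n - 1) * unitBallVolume (n - 1)`. Cauchy's formula then bounds its surface area, and `c →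
1`. -/
theorem surfaceArea_closedBall_le (hn : 1 ≤ n) :
    surfaceArea (closedBall (0 : EuclideanSpace ℝ (Fin n)) 1) ≤ n * unitBallVolume n := by
  have : Nonempty (Fin n) := ⟨⟨0, hn⟩⟩
  have hw' := unitBallVolume_pos (n - 1)
  have hcont : Continuous fun c : ℝ => c ^ (n - 1) * (n * unitBallVolume n) := by fun_prop
  have ht := (hcont.tendsto 1).mono_left (nhdsWithin_le_nhds (s := Set.Ioi 1))
  simp only [one_pow, one_mul] at ht
  refine ge_of_tendsto ht ?_
  filter_upwards [self_mem_nhdsWithin] with c (hc : 1 < c)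
  have hc0 : 0 ≤ c := by linarith
  obtain ⟨k, ν, d, hν, h1, h2⟩ := exists_polyhedron_between
    (convex_closedBall (0 : EuclideanSpace ℝ (Fin n)) 1) (isCompact_closedBall _ _)
    ⟨0, mem_closedBall_self zero_le_one⟩ (isCompact_closedBall (0 : EuclideanSpace ℝ (Fin n)) c)
    ((closedBall_subset_ball hc).trans ball_subset_interior_closedBall)
  have hb : Bornology.IsBounded (polyhedron ν d) := isBounded_closedBall.subset h2
  have hSP : surfaceArea (closedBall (0 : EuclideanSpace ℝ (Fin n)) 1) ≤
      surfaceArea (polyhedron ν d) :=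
    surfaceArea_mono hn (convex_closedBall _ _) isClosed_closedBall
      ⟨0, ball_subset_interior_closedBall (mem_ball_self one_pos)⟩ (convex_polyhedron ν d)
      (isCompact_of_isClosed_isBounded (isClosed_polyhedron ν d) hb) (h1.trans interior_subset)
  refine hSP.trans ?_
  have hle : ∀ u : sphere (0 : EuclideanSpace ℝ (Fin n)) 1,
      facetGauge ν d u ≤ c ^ (n - 1) * unitBallVolume (n - 1) := by
    intro u
    have hu : ‖(u : EuclideanSpace ℝ (Fin n))‖ = 1 := by simp
    have h3 := (le_starProjection_polyhedron hn hν hb hu).trans (measure_mono (Set.image_mono h2))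
    rw [euclideanHausdorffMeasure_starProjection_closedBall hn hu 0 hc0] at h3
    exact (ENNReal.ofReal_le_ofReal_iff (by positivity)).mp h3
  have hint : Integrable (fun u : sphere (0 : EuclideanSpace ℝ (Fin n)) 1 => facetGauge ν d u)
      (volume : Measure (EuclideanSpace ℝ (Fin n))).toSphere :=
    Continuous.integrable_of_hasCompactSupport
      ((continuous_facetGauge ν d).comp continuous_subtype_val)
      (HasCompactSupport.of_compactSpace _)
  have h4 := integral_mono hint (integrable_const _) hle
  rw [integral_facetGauge hn hν hb, integral_const, smul_eq_mul, toSphere_real_univ] at h4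
  refine le_of_mul_le_mul_left (h4.trans (le_of_eq ?_)) hw'
  ring

theorem polarProjectionBody_closedBall (hn : 1 ≤ n) :
    polarProjectionBody (closedBall (0 : EuclideanSpace ℝ (Fin n)) 1) =
      closedBall 0 (unitBallVolume (n - 1))⁻¹ := by
  have hw' := unitBallVolume_pos (n - 1)
  have hproj : ∀ u : EuclideanSpace ℝ (Fin n), ‖u‖ = 1 →
      projectionVolume (closedBall (0 : EuclideanSpace ℝ (Fin n)) 1) u = unitBallVolume (n - 1) :=
    fun u hu => by rw [projectionVolume_closedBall hn hu 0 zero_le_one, one_pow, one_mul]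
  refine (polarProjectionBody_subset_closedBall hw' fun u hu => (hproj u hu).ge).antisymm ?_
  intro x hx
  rw [mem_closedBall_zero_iff, ← one_div, le_div_iff₀ hw'] at hx
  exact mem_polarProjectionBody fun u hu _ => by rwa [hproj u hu]

end PolarProjection

theorem mainTheorem2 (n : ℕ) (hn : 1 ≤ n) :
    (∀ K : ConvexBody (EuclideanSpace ℝ (Fin n)),
      (interior (K : Set (EuclideanSpace ℝ (Fin n)))).Nonempty →
      surfaceArea (K : Set (EuclideanSpace ℝ (Fin n))) ^ n *
          volume.real (polarProjectionBody (K : Set (EuclideanSpace ℝ (Fin n)))) ≥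
        unitBallVolume n * (n * unitBallVolume n / unitBallVolume (n - 1)) ^ n) ∧
    surfaceArea (closedBall (0 : EuclideanSpace ℝ (Fin n)) 1) ^ n *
        volume.real (polarProjectionBody (closedBall (0 : EuclideanSpace ℝ (Fin n)) 1)) =
      unitBallVolume n * (n * unitBallVolume n / unitBallVolume (n - 1)) ^ n := by
  refine ⟨fun K hK => le_surfaceArea_pow_mul hn K.convex K.isCompact hK, le_antisymm ?_ ?_⟩
  · have hw := unitBallVolume_pos n
    have hw' := unitBallVolume_pos (n - 1)
    rw [polarProjectionBody_closedBall hn, volume_real_closedBall_zero n (by positivity)]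
    have hS : 0 ≤ surfaceArea (closedBall (0 : EuclideanSpace ℝ (Fin n)) 1) := measureReal_nonneg
    calc _ ≤ (n * unitBallVolume n) ^ n * ((unitBallVolume (n - 1))⁻¹ ^ n * unitBallVolume n) := by
          gcongr
          exact surfaceArea_closedBall_le hn
      _ = _ := by rw [← mul_assoc, ← mul_pow, mul_comm, div_eq_mul_inv]
  · exact le_surfaceArea_pow_mul hn (convex_closedBall _ _) (isCompact_closedBall _ _)
      ⟨0, ball_subset_interior_closedBall (mem_ball_self one_pos)⟩
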